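/- **Theorem (Federated oracle complexity of FedAve).** *Problem.* Let $f:[0,1]^d\times\mathbb{R}^p\to\mathbb{R}$, $p\ge 1$, be a loss function. There are $m\ge 1$ clients; client $c\in\{1,\dots,m\}$ holds samples $x^{(c,1)},\dots,x^{(c,s)}\in[0,1]^d$ ($s\ge 1$) and the server holds samples $x^{(0,1)},\dots,x^{(0,r)}\in[0,1]^d$ ($r\ge 0$). With $n=ms+r$ let $$F(\theta)=\frac1n\sum_{j=1}^r f(x^{(0,j)};\theta)+\frac1n\sum_{c=1}^m\sum_{j=1}^s f(x^{(c,j)};\theta),$$ let $\theta^\star$ be its minimizer and $F_*=F(\theta^\star)$. Assume that for all $x\in[0,1]^d$ the gradient $\nabla_\theta f(x;\cdot)$ exists and is $L_1$-Lipschitz, and that $f(x;\cdot)$ is $\mu$-strongly convex, i.e. $f(x;\theta_1)\ge f(x;\theta_2)+\nabla_\theta f(x;\theta_2)^{\mathrm T}(\theta_1-\theta_2)+\frac{\mu}{2}\|\theta_1-\theta_2\|_2^2$ for all $\theta_1,\theta_2$, where $L_1>\mu>0$. *Algorithm.* FedAve with parameter $b\in\mathbb{N}=\{1,2,\dots\}$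 starts at $\theta^{(0)}\in\mathbb{R}^p$. In epoch $k=0,1,2,\dots$ the server chooses a set $S_k$ of $\tau m\in\mathbb{N}$ active clients, uniformly at random, where $\tau\in(0,1]$. Each $c\in S_k$ starts at $u_{c,0}=\theta^{(k)}$ and makes $b$ steps $u_{c,t+1}=u_{c,t}-\eta_k\widetilde\nabla f_c(u_{c,t})$ with fresh independent stochastic gradients, and the server sets $\theta^{(k+1)}=\frac{1}{\tau m}\sum_{c\in S_k}u_{c,b}$. The step sizes are $\eta_k=\frac{4}{\mu(kb+1)}$ for all $k\ge T_0$, with $T_0=T_0(b)$ as below; the step sizes $\eta_k$ with $k<T_0$ are arbitrary (in particular, the same formula may be used). *Assumptions.* Fix constants $\tau\in(0,1]$, $L_1>\mu>0$ and $C_\sigma,C_b,C_\theta,c_0,c_1,\delta>0$; all other parameters may vary. 1. For all $c$ and $\theta$, the stochastic gradient $\widetilde\nabla f_c(\theta)$ is an unbiased estimator of the full gradient $\nabla F(\theta)$, and $\mathbb{E}\big\|\widetilde\nabla f_c(\theta)-\frac1s\sum_{j=1}^s\nabla_\theta f(x^{(c,j)};\theta)\big\|_2^2\le\sigma^2$,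 where $0<\sigma^2\le C_\sigma p$. 2. Only $b\le C_b m$ is considered. 3. For each such $b$ there is $T_0\in\mathbb{N}$ with $c_0\frac mb\le T_0\le c_1\frac mb$ such that $\mathbb{E}\|\theta^{(T_0)}-\theta^\star\|_2^2\le C_\theta p$. *Complexity.* Let $\phi>0$ be the communication-to-computation ratio. The federated oracle complexity of an algorithm with $T$ epochs is $\sum_{t=1}^T\big(b_t+\mathbf 1\{\text{clients communicate in epoch }t\}\,\phi\tau m\big)$, where $b_t$ is the number of gradients that each active client computes in epoch $t$; for FedAve this is $T(b+\phi\tau m)$. Let $\Gamma(\mathsf{FedAve})$ be the minimum of this quantity over all $b\in\mathbb{N}$ with $b\le C_bm$ and all $T\in\mathbb{N}$ such that $\mathbb{E}[F(\theta^{(T)})]-F_*\le\epsilon$ (and $\infty$ if there are none). *Conclusion.* There are constants $C,\phi_0,m_0>0$, depending only on $\tau,L_1,\mu,C_\sigma,C_b,C_\theta,c_0,c_1,\delta$, such that for all $\epsilon\in(0,1]$, all $\phi\ge\phi_0$ and all sufficiently large $m$, namely all $m\ge m_0$ with $m\ge\delta\,(p/\epsilon)^{1/8}$, $$\Gamma(\mathsf{FedAve})\le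 C\,\phi\, m\left(\frac p\epsilon\right)^{3/4}.$$ -/

import Mathlib

open MeasureTheory ProbabilityTheory
open scoped ENNReal Gradient

noncomputable section

/-- The parameter space `ℝ^p` with its Euclidean norm. -/
abbrev Param (p : ℕ) : Type := EuclideanSpace ℝ (Fin p)

/-- The data space `[0,1]^d`. -/
abbrev DataPoint (d : ℕ) : Type := Fin d → Set.Icc (0 : ℝ) 1

/-- The data of a federated empirical risk minimization problem: a loss function
`f : [0,1]^d × ℝ^p → ℝ`, `r` training samples at the server, and `s` training samples at each
of the `m` clients. -/
structure FederatedERM (d p m s r : ℕ) where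
  loss : DataPoint d → Param p → ℝ
  serverData : Fin r → DataPoint d
  clientData : Fin m → Fin s → DataPoint d

namespace FederatedERM

variable {d p m s r : ℕ}

/-- The empirical risk `F`, the average of the loss over all `n = m s + r` training samples. -/
def risk (Q : FederatedERM d p m s r) (θ : Param p) : ℝ :=
  (1 / ((m : ℝ) * s + r)) *
    (∑ j, Q.loss (Q.serverData j) θ + ∑ c, ∑ j, Q.loss (Q.clientData c j) θ)

/-- The average `(1/s) ∑_j ∇_θ f(x^{(c,j)}; θ)` of the gradients at the samples of client `c`. -/
def clientGradient (Q : FederatedERM d p m s r) (c : Fin m) (θ : Param p) : Param p :=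
  (1 / (s : ℝ)) • ∑ j, ∇ (Q.loss (Q.clientData c j)) θ

/-- Smoothness in the parameter: for every data point, the gradient of the loss in the parameter
exists and is `L`-Lipschitz. -/
def SmoothInParameter (Q : FederatedERM d p m s r) (L : ℝ) : Prop :=
  ∀ x, Differentiable ℝ (Q.loss x) ∧
    ∀ θ₁ θ₂ : Param p, ‖∇ (Q.loss x) θ₁ - ∇ (Q.loss x) θ₂‖ ≤ L * ‖θ₁ - θ₂‖

/-- Strong convexity: for every data point, the loss is `μ`-strongly convex in the parameter. -/
def StronglyConvexInParameter (Q : FederatedERM d p m s r) (μ : ℝ) : Prop :=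
  ∀ x, ∀ θ₁ θ₂ : Param p,
    Q.loss x θ₂ + inner ℝ (∇ (Q.loss x) θ₂) (θ₁ - θ₂) + μ / 2 * ‖θ₁ - θ₂‖ ^ 2 ≤ Q.loss x θ₁

/-- The random parameter `X` is an `ε`-approximate solution, `E[F(X)] - F_* ≤ ε`, where `θstar`
is a minimizer of `F` and thus `F_* = F(θstar)`. -/
def IsApproxSolution (Q : FederatedERM d p m s r) (θstar : Param p) (ε : ℝ)
    {Ω : Type*} [MeasurableSpace Ω] (P : Measure Ω) (X : Ω → Param p) : Prop :=
  Integrable (fun ω => Q.risk (X ω)) P ∧ ∫ ω, Q.risk (X ω) ∂P - Q.risk θstar ≤ ε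

/-- Stochastic gradients for the problem: client `c` draws a sample `ζ` with law `ν c` and computes
`G c ζ θ`. The stochastic gradients are unbiased estimators of the gradient of `F`, and their mean
squared distance from the average gradient over the samples of the client is at most `σ ^ 2`. -/
structure IsStochasticGradient (Q : FederatedERM d p m s r) {Ξ : Type*} [MeasurableSpace Ξ]
    (ν : Fin m → Measure Ξ) (G : Fin m → Ξ → Param p → Param p) (σ : ℝ) : Prop where
  prob : ∀ c, IsProbabilityMeasure (ν c)
  meas : ∀ c, Measurable (fun z : Ξ × Param p => G c z.1 z.2)
  integrable : ∀ c θ, Integrable (fun ζ => G c ζ θ) (ν c)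
  unbiased : ∀ c θ, ∫ ζ, G c ζ θ ∂(ν c) = ∇ Q.risk θ
  variance_le : ∀ c θ,
    ∫⁻ ζ, ‖G c ζ θ - Q.clientGradient c θ‖ₑ ^ 2 ∂(ν c) ≤ ENNReal.ofReal (σ ^ 2)

end FederatedERM

/-- The random choices of federated averaging. In epoch `k` the set `S k` of active clients is
uniform among the sets of `K` clients, and `ξ k c t`, with law `ν c`, is the sample that client `c`
draws for its stochastic gradient in local step `t`. All these choices are mutually independent. -/
structure IsFedAveRandomness {m : ℕ} (K : ℕ) {Ξ : Type*} [MeasurableSpace Ξ]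
    (ν : Fin m → Measure Ξ) {Ω : Type*} [MeasurableSpace Ω] (P : Measure Ω)
    (S : ℕ → Ω → Finset (Fin m)) (ξ : ℕ → Fin m → ℕ → Ω → Ξ) : Prop where
  meas_active : ∀ k A, MeasurableSet {ω | S k ω = A}
  law_active : ∀ k A, P {ω | S k ω = A} = if A.card = K then ((m.choose K : ℕ) : ℝ≥0∞)⁻¹ else 0
  meas_sample : ∀ k c t, Measurable (ξ k c t)
  law_sample : ∀ k c t, P.map (ξ k c t) = ν c
  indep : iIndep (fun i : ℕ ⊕ (ℕ × Fin m × ℕ) => match i with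
    | .inl k => MeasurableSpace.comap (S k) ⊤
    | .inr (k, c, t) => MeasurableSpace.comap (ξ k c t) inferInstance) P

/-- The local iterates of stochastic gradient descent with constant step size `η`, started at `θ`,
with stochastic gradient `g` and samples `ζ 0, ζ 1, …`. -/
def localSGD {p : ℕ} {Ξ : Type*} (g : Ξ → Param p → Param p) (η : ℝ) (ζ : ℕ → Ξ) (θ : Param p) :
    ℕ → Param p
  | 0 => θ
  | t + 1 => localSGD g η ζ θ t - η • g (ζ t) (localSGD g η ζ θ t)

/-- The parameter `θ^{(k)}` at the server after `k` epochs of federated averaging started at `θ₀`.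
In epoch `k` each of the `K` active clients performs `b` steps of stochastic gradient descent with
step size `η k` from the parameter of the server, and the server averages the results. -/
def fedAve {p m : ℕ} {Ξ Ω : Type*} (G : Fin m → Ξ → Param p → Param p) (K b : ℕ) (η : ℕ → ℝ)
    (θ₀ : Param p) (S : ℕ → Ω → Finset (Fin m)) (ξ : ℕ → Fin m → ℕ → Ω → Ξ) (ω : Ω) :
    ℕ → Param p
  | 0 => θ₀
  | k + 1 => fedAve G K b η θ₀ S ξ ω k + (1 / (K : ℝ)) • ∑ c ∈ S k ω,
      (localSGD (G c) (η k) (fun t => ξ k c t ω) (fedAve G K b η θ₀ S ξ ω k) b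
        - fedAve G K b η θ₀ S ξ ω k)

/-- The federated oracle complexity of `T` epochs: in epoch `t`, each active client (or the server)
computes `b t` gradients, and the `τ m` active clients communicate if `t ∈ comm`, at cost `φ` per
client. -/
def federatedOracleComplexity (φ τ : ℝ) (m T : ℕ) (b : Fin T → ℕ) (comm : Finset (Fin T)) : ℝ :=
  ∑ t, ((b t : ℝ) + if t ∈ comm then φ * τ * m else 0)

/-- The federated oracle complexity of federated averaging: the minimum over all numbers
`b ∈ {1, 2, …}`, `b ≤ bmax`, of gradients per client and epoch and all numbers `T ∈ {1, 2, …}` of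
epochs such that the parameter `X b T` after `T` epochs is an `ε`-approximate solution; it is `∞`
if there are none. In every epoch the active clients compute `b` gradients and communicate. -/
def fedAveComplexity {d p m s r : ℕ} (Q : FederatedERM d p m s r) (θstar : Param p)
    (φ τ ε bmax : ℝ) {Ω : Type*} [MeasurableSpace Ω] (P : Measure Ω)
    (X : ℕ → ℕ → Ω → Param p) : ℝ≥0∞ :=
  ⨅ (b : ℕ) (T : ℕ) (_ : 1 ≤ b ∧ (b : ℝ) ≤ bmax ∧ 1 ≤ T ∧ Q.IsApproxSolution θstar ε P (X b T)),
    ENNReal.ofReal (federatedOracleComplexity φ τ m T (fun _ => b) Finset.univ)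

end

/-! Every stochastic gradient is unbiased for the full gradient `∇F`, so each client runs SGD on `F`
itself, and for each fixed choice of active clients an epoch averages `K = τm` independent runs from
a common start. Averaging divides the variance by `K`, but not the bias.

For one run with step size `η` and factor `ρ = 1 - 3/4 ημ`, an exact gradient step contracts by `ρ`.
Hence the variance after at most `b` steps is at most `bη²σ²` (`localSGD_variance_le`). The mean
would contract towards `θ*` if `∇F` were affine; the nonlinearity costs at most `ηL` times the
standard deviation per step, so the mean approaches a ball of radius `B ~ η√b σ`
(`norm_integral_localSGD_sub_le`). With `E_k = E‖θ^(k) - θ*‖²` this gives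
(`lintegral_fedAve_succ_le`) `E_(k+1) ≤ ρ^b E_k + (1 - ρ^b) B² + bη²σ²/K`.

For `η_k = 4/(μ(kb+1))` the factor is at most `(k+1)/(k+4)` and the errors are of order `σ²/(b k³)`
and `σ²/(bK k²)`. Thus `E_T` is at most of order `T₀³p/T³ + σ²/(bT²) + σ²/(bKT)`
(`lintegral_fedAve_sub_sq_le`).

Taking `b` of order `m` keeps `T₀` bounded and makes `bK` of order `m²`. With `T` of order
`(p/ε)^(3/4)` the first two terms are of order at most `ε`, and so is the third because `m² ≥
δ²(p/ε)^(1/4)`. The cost `T(b + φτm)` is then of order `φ m (p/ε)^(3/4)`. -/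

noncomputable section

/-! ### Deterministic gradient steps -/

section Deterministic

variable {E : Type*} [NormedAddCommGroup E] [InnerProductSpace ℝ E]

/-- A gradient step for a smooth and strongly monotone field contracts distances. -/
theorem norm_gradientStep_sub_le {h : E → E} {L μ η : ℝ} (hμ : 0 < μ) (hL : μ < L) (hη : 0 ≤ η)
    (hηL : η * L ^ 2 ≤ μ / 2) (hlip : ∀ x y, ‖h x - h y‖ ≤ L * ‖x - y‖)
    (hmono : ∀ x y, μ * ‖x - y‖ ^ 2 ≤ inner ℝ (h x - h y) (x - y)) (x y : E) :
    ‖(x - η • h x) - (y - η • h y)‖ ≤ (1 - 3 / 4 * (η * μ)) * ‖x - y‖ := by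
  have hημ : η * μ ≤ 1 / 2 := by
    have h1 : η * μ ^ 2 ≤ η * L ^ 2 := by gcongr
    have h2 : μ * (η * μ) ≤ μ * (1 / 2) := by nlinarith
    exact le_of_mul_le_mul_left h2 hμ
  refine le_of_sq_le_sq ?_ (mul_nonneg (by linarith) (norm_nonneg _))
  have e : (x - η • h x) - (y - η • h y) = (x - y) - η • (h x - h y) := by
    rw [smul_sub]; abel
  rw [e, norm_sub_sq_real, inner_smul_right, norm_smul, Real.norm_of_nonneg hη,
    real_inner_comm]
  have h1 := hmono x y
  have h2 : ‖h x - h y‖ ^ 2 ≤ (L * ‖x - y‖) ^ 2 := by gcongr; exact hlip x y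
  have h3 : η * (μ * ‖x - y‖ ^ 2) ≤ η * inner ℝ (h x - h y) (x - y) := by gcongr
  have h4 : η ^ 2 * ‖h x - h y‖ ^ 2 ≤ η ^ 2 * (L * ‖x - y‖) ^ 2 := by gcongr
  -- The squared factor is at most `1 - 2ημ + η²L² ≤ 1 - 3/2 ημ ≤ (1 - 3/4 ημ)²`.
  have h5 : η * (η * L ^ 2) * ‖x - y‖ ^ 2 ≤ η * (μ / 2) * ‖x - y‖ ^ 2 := by gcongr
  nlinarith [mul_nonneg (sq_nonneg (η * μ)) (sq_nonneg ‖x - y‖)]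

/-- Adding the two strong convexity inequalities gives strong monotonicity. -/
theorem stronglyMonotone_of_stronglyConvex {F : E → ℝ} {h : E → E} {μ : ℝ}
    (hF : ∀ x y, F y + inner ℝ (h y) (x - y) + μ / 2 * ‖x - y‖ ^ 2 ≤ F x) (x y : E) :
    μ * ‖x - y‖ ^ 2 ≤ inner ℝ (h x - h y) (x - y) := by
  have h1 := hF x y
  have h2 := hF y x
  rw [norm_sub_rev y x, ← neg_sub x y, inner_neg_right] at h2
  rw [inner_sub_left]
  linarith

/-- Convexity at `x` gives `F x - F y ≤ ⟨h x, x - y⟩`, and `‖h x‖ ≤ L‖x - y‖` because `h y = 0`.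
This loses a factor 2 against the descent lemma but needs no integration along the segment. -/
theorem sub_le_mul_norm_sub_sq_of_stronglyConvex {F : E → ℝ} {h : E → E} {L μ : ℝ} (hμ : 0 ≤ μ)
    (hF : ∀ x y, F y + inner ℝ (h y) (x - y) + μ / 2 * ‖x - y‖ ^ 2 ≤ F x)
    (hlip : ∀ x y, ‖h x - h y‖ ≤ L * ‖x - y‖) {y : E} (hy : h y = 0) (x : E) :
    F x - F y ≤ L * ‖x - y‖ ^ 2 := by
  have h1 := hF y x
  have h2 := hlip x y
  rw [hy, sub_zero] at h2
  have h3 := real_inner_le_norm (h x) (x - y)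
  rw [← neg_sub x y, inner_neg_right, norm_neg] at h1
  have h4 : ‖h x‖ * ‖x - y‖ ≤ L * ‖x - y‖ * ‖x - y‖ := by gcongr
  have h5 : 0 ≤ μ / 2 * ‖x - y‖ ^ 2 := by positivity
  nlinarith

theorem gradient_eq_zero_of_forall_le [CompleteSpace E] {F : E → ℝ} {y : E}
    (h : ∀ x, F y ≤ F x) : ∇ F y = 0 := by
  have : fderiv ℝ F y = 0 :=
    IsLocalMin.fderiv_eq_zero (Filter.Eventually.of_forall h)
  simp [gradient, this]

end Deterministic

/-! ### Regularity of the empirical risk -/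

namespace FederatedERM

variable {d p m s r : ℕ} (Q : FederatedERM d p m s r)

/-- The gradient of the empirical risk, written as an average over the training samples. -/
def riskGradient (θ : Param p) : Param p :=
  (1 / ((m : ℝ) * s + r)) •
    (∑ j, ∇ (Q.loss (Q.serverData j)) θ + ∑ c, ∑ j, ∇ (Q.loss (Q.clientData c j)) θ)

variable {Q} {L μ : ℝ}

theorem hasGradientAt_risk (hQ : Q.SmoothInParameter L) (θ : Param p) :
    HasGradientAt Q.risk (Q.riskGradient θ) θ := by
  have key : ∀ x, HasFDerivAt (Q.loss x) (InnerProductSpace.toDual ℝ _ (∇ (Q.loss x) θ)) θ :=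
    fun x => ((hQ x).1 θ).hasGradientAt.hasFDerivAt
  rw [hasGradientAt_iff_hasFDerivAt, riskGradient]
  simp only [map_smulₛₗ, map_add, map_sum]
  have := ((HasFDerivAt.fun_sum (u := Finset.univ) fun j _ => key (Q.serverData j)).add
    (HasFDerivAt.fun_sum (u := Finset.univ) fun c _ =>
      HasFDerivAt.fun_sum (u := Finset.univ) fun j _ => key (Q.clientData c j))).const_mul
        (1 / ((m : ℝ) * s + r))
  exact this

theorem gradient_risk (hQ : Q.SmoothInParameter L) : ∇ Q.risk = Q.riskGradient :=
  gradient_eq (hasGradientAt_risk hQ)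

theorem norm_gradient_risk_sub_le (hQ : Q.SmoothInParameter L) (hn : 0 < (m : ℝ) * s + r)
    (x y : Param p) : ‖∇ Q.risk x - ∇ Q.risk y‖ ≤ L * ‖x - y‖ := by
  rw [gradient_risk hQ, riskGradient, riskGradient, ← smul_sub, norm_smul,
    Real.norm_of_nonneg (by positivity), one_div, inv_mul_le_iff₀ hn, add_sub_add_comm]
  simp only [← Finset.sum_sub_distrib]
  calc _ ≤ ∑ _j : Fin r, L * ‖x - y‖ + ∑ _c : Fin m, ∑ _j : Fin s, L * ‖x - y‖ := by
        refine (norm_add_le _ _).trans (add_le_add ?_ ?_)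
        · exact norm_sum_le_of_le _ fun j _ => (hQ _).2 x y
        · exact norm_sum_le_of_le _ fun c _ => norm_sum_le_of_le _ fun j _ => (hQ _).2 x y
    _ = _ := by simp; ring

theorem stronglyConvex_risk (hQ : Q.SmoothInParameter L) (hc : Q.StronglyConvexInParameter μ)
    (hn : 0 < (m : ℝ) * s + r) (x y : Param p) :
    Q.risk y + inner ℝ (∇ Q.risk y) (x - y) + μ / 2 * ‖x - y‖ ^ 2 ≤ Q.risk x := by
  have h1 := Finset.sum_le_sum fun j (_ : j ∈ Finset.univ) => hc (Q.serverData j) x y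
  have h2 := Finset.sum_le_sum fun c (_ : c ∈ Finset.univ) =>
    Finset.sum_le_sum fun j (_ : j ∈ Finset.univ) => hc (Q.clientData c j) x y
  rw [gradient_risk hQ, riskGradient, risk, risk, real_inner_smul_left,
    inner_add_left, sum_inner, sum_inner]
  simp only [sum_inner]
  simp only [Finset.sum_add_distrib, Finset.sum_const, Finset.card_univ, Fintype.card_fin,
    nsmul_eq_mul] at h1 h2
  have hN : (1 / ((m : ℝ) * s + r)) * ((m : ℝ) * s + r) = 1 := one_div_mul_cancel hn.ne'
  have h3 := mul_le_mul_of_nonneg_left (add_le_add h1 h2)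
    (show 0 ≤ 1 / ((m : ℝ) * s + r) by positivity)
  generalize 1 / ((m : ℝ) * s + r) = a at *
  linear_combination h3 - hN * (μ / 2 * ‖x - y‖ ^ 2)

end FederatedERM

/-! ### Second moments and orthogonality -/

section SecondMoments

variable {Ω : Type*} [MeasurableSpace Ω] {P : Measure Ω}

/-- The joint law is a product, so Tonelli allows `X` to be frozen. This plays the role of
conditioning on the past. -/
theorem ProbabilityTheory.IndepFun.lintegral_comp_prodMk [IsFiniteMeasure P] {α β : Type*}
    [MeasurableSpace α] [MeasurableSpace β] {X : Ω → α} {Y : Ω → β} (h : IndepFun X Y P)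
    (hX : Measurable X) (hY : Measurable Y) {f : α × β → ℝ≥0∞} (hf : Measurable f) :
    ∫⁻ ω, f (X ω, Y ω) ∂P = ∫⁻ ω, ∫⁻ ω', f (X ω, Y ω') ∂P ∂P := by
  rw [← lintegral_map (f := f) hf (hX.prodMk hY),
    h.map_prod_eq_prod_map_map hX.aemeasurable hY.aemeasurable,
    lintegral_prod _ hf.aemeasurable, lintegral_map hf.lintegral_prod_right' hX]
  refine lintegral_congr fun ω => ?_
  exact lintegral_map (hf.comp measurable_prodMk_left) hY

variable {E : Type*} [NormedAddCommGroup E]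

theorem memLp_two_of_lintegral_lt_top {X : Ω → E} (hX : AEStronglyMeasurable X P)
    (h : ∫⁻ ω, ‖X ω‖ₑ ^ 2 ∂P < ∞) : MemLp X 2 P := by
  refine ⟨hX, ?_⟩
  rw [eLpNorm_lt_top_iff_lintegral_rpow_enorm_lt_top two_ne_zero ENNReal.ofNat_ne_top]
  simpa using h

theorem MeasureTheory.MemLp.lintegral_enorm_sq_eq {X : Ω → E} (hX : MemLp X 2 P) :
    ∫⁻ ω, ‖X ω‖ₑ ^ 2 ∂P = ENNReal.ofReal (∫ ω, ‖X ω‖ ^ 2 ∂P) := by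
  rw [ofReal_integral_eq_lintegral_ofReal
    ((memLp_two_iff_integrable_sq_norm hX.1).1 hX) (ae_of_all _ fun _ => by positivity)]
  refine lintegral_congr fun ω => ?_
  rw [ENNReal.ofReal_pow (norm_nonneg _), ofReal_norm]

variable [InnerProductSpace ℝ E]

theorem MeasureTheory.MemLp.integrable_inner_of_two {X Y : Ω → E} (hX : MemLp X 2 P)
    (hY : MemLp Y 2 P) : Integrable (fun ω => inner ℝ (X ω) (Y ω)) P := by
  refine Integrable.mono' (((memLp_two_iff_integrable_sq_norm hX.1).1 hX).add
    ((memLp_two_iff_integrable_sq_norm hY.1).1 hY)) (hX.1.inner hY.1) (ae_of_all _ fun ω => ?_)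
  refine (norm_inner_le_norm _ _).trans ?_
  simp only [Pi.add_apply]
  nlinarith [sq_nonneg (‖X ω‖ - ‖Y ω‖), sq_nonneg (‖X ω‖ + ‖Y ω‖)]

theorem integral_norm_add_sq_of_integral_inner_eq_zero {X Y : Ω → E} (hX : MemLp X 2 P)
    (hY : MemLp Y 2 P) (h : ∫ ω, inner ℝ (X ω) (Y ω) ∂P = 0) :
    ∫ ω, ‖X ω + Y ω‖ ^ 2 ∂P = ∫ ω, ‖X ω‖ ^ 2 ∂P + ∫ ω, ‖Y ω‖ ^ 2 ∂P := by
  have hX2 := (memLp_two_iff_integrable_sq_norm hX.1).1 hX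
  have hY2 := (memLp_two_iff_integrable_sq_norm hY.1).1 hY
  have hXY := (hX.integrable_inner_of_two hY).const_mul 2
  simp_rw [norm_add_sq_real]
  refine (integral_add (hX2.add hXY) hY2).trans ?_
  refine congrArg (· + _) ((integral_add hX2 hXY).trans ?_)
  rw [integral_const_mul, h, mul_zero, add_zero]

variable [CompleteSpace E] [IsProbabilityMeasure P]

/-- Bias-variance decomposition: the centred variable is orthogonal to constants. -/
theorem integral_norm_sub_sq_eq {X : Ω → E} (hX : MemLp X 2 P) (a : E) :
    ∫ ω, ‖X ω - a‖ ^ 2 ∂P = ∫ ω, ‖X ω - P[X]‖ ^ 2 ∂P + ‖P[X] - a‖ ^ 2 := by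
  have hi : Integrable X P := hX.integrable one_le_two
  have h := integral_norm_add_sq_of_integral_inner_eq_zero (hX.sub (memLp_const (P[X])))
    (memLp_const (μ := P) (p := 2) (P[X] - a)) (by
      simp_rw [real_inner_comm (P[X] - a)]
      rw [integral_inner (hi.sub (integrable_const _))]
      simp [integral_sub hi])
  simpa using h

theorem integral_norm_sub_integral_sq_le {X : Ω → E} (hX : MemLp X 2 P) (a : E) :
    ∫ ω, ‖X ω - P[X]‖ ^ 2 ∂P ≤ ∫ ω, ‖X ω - a‖ ^ 2 ∂P := by
  rw [integral_norm_sub_sq_eq hX a]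
  linarith [sq_nonneg ‖P[X] - a‖]

theorem norm_integral_sq_le {X : Ω → E} (hX : MemLp X 2 P) :
    ‖P[X]‖ ^ 2 ≤ ∫ ω, ‖X ω‖ ^ 2 ∂P := by
  have h := integral_norm_sub_sq_eq hX 0
  simp only [sub_zero] at h
  rw [h]
  linarith [integral_nonneg (μ := P) (f := fun ω => ‖X ω - P[X]‖ ^ 2) fun ω => by positivity]

omit [CompleteSpace E] [IsProbabilityMeasure P] in
theorem integral_norm_sum_sq_of_pairwise {ι : Type*} (s : Finset ι) {X : ι → Ω → E}
    (hX : ∀ i ∈ s, MemLp (X i) 2 P)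
    (h : ∀ i ∈ s, ∀ j ∈ s, i ≠ j → ∫ ω, inner ℝ (X i ω) (X j ω) ∂P = 0) :
    ∫ ω, ‖∑ i ∈ s, X i ω‖ ^ 2 ∂P = ∑ i ∈ s, ∫ ω, ‖X i ω‖ ^ 2 ∂P := by
  classical
  induction s using Finset.induction_on with
  | empty => simp
  | insert i s hi ih =>
    have hs : ∀ j ∈ s, MemLp (X j) 2 P := fun j hj => hX j (Finset.mem_insert_of_mem hj)
    simp_rw [Finset.sum_insert hi]
    rw [integral_norm_add_sq_of_integral_inner_eq_zero (hX i (Finset.mem_insert_self _ _))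
      (memLp_finsetSum _ hs), ih hs]
    · exact fun j hj k hk => h j (Finset.mem_insert_of_mem hj) k (Finset.mem_insert_of_mem hk)
    · simp_rw [inner_sum]
      rw [integral_finsetSum _ fun j hj =>
        (hX i (Finset.mem_insert_self _ _)).integrable_inner_of_two (hs j hj)]
      exact Finset.sum_eq_zero fun j hj => h i (Finset.mem_insert_self _ _) j
        (Finset.mem_insert_of_mem hj) (by rintro rfl; exact hi hj)

end SecondMoments

/-! ### One stochastic gradient step -/

section StochasticStep

variable {Ω Ξ E : Type*} [MeasurableSpace Ω] {P : Measure Ω} [IsProbabilityMeasure P]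
  [MeasurableSpace Ξ] {ν : Measure Ξ} [NormedAddCommGroup E] [InnerProductSpace ℝ E]
  [FiniteDimensional ℝ E] [MeasurableSpace E] [BorelSpace E]
  {g : Ξ → E → E} {h : E → E} {σ : ℝ}

/-- An oracle `g` that, given a sample with law `ν`, returns an unbiased estimate of the field `h`
with variance at most `σ ^ 2`. -/
structure IsUnbiasedOracle (ν : Measure Ξ) (g : Ξ → E → E) (h : E → E) (σ : ℝ) : Prop where
  prob : IsProbabilityMeasure ν
  meas : Measurable (fun z : Ξ × E => g z.1 z.2)
  meas_field : Measurable h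
  integrable : ∀ x, Integrable (fun z => g z x) ν
  unbiased : ∀ x, ∫ z, g z x ∂ν = h x
  variance_le : ∀ x, ∫⁻ z, ‖g z x - h x‖ₑ ^ 2 ∂ν ≤ ENNReal.ofReal (σ ^ 2)

namespace IsUnbiasedOracle

variable (hg : IsUnbiasedOracle ν g h σ) {U : Ω → E} {ζ : Ω → Ξ}
  (hU : Measurable U) (hζ : Measurable ζ) (hlaw : P.map ζ = ν) (hind : IndepFun U ζ P)

include hg hU hζ hlaw hind

theorem lintegral_noise_le :
    ∫⁻ ω, ‖g (ζ ω) (U ω) - h (U ω)‖ₑ ^ 2 ∂P ≤ ENNReal.ofReal (σ ^ 2) := by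
  have hm : Measurable fun z : E × Ξ => ‖g z.2 z.1 - h z.1‖ₑ ^ 2 :=
    ((hg.meas.comp measurable_swap).sub (hg.meas_field.comp measurable_fst)).enorm.pow_const 2
  rw [hind.lintegral_comp_prodMk hU hζ hm]
  calc _ ≤ ∫⁻ _, ENNReal.ofReal (σ ^ 2) ∂P := by
        refine lintegral_mono fun ω => ?_
        rw [← lintegral_map (f := fun z => ‖g z (U ω) - h (U ω)‖ₑ ^ 2)
          (hm.comp measurable_prodMk_left) hζ, hlaw]
        exact hg.variance_le _
    _ = _ := by simp

theorem memLp_noise : MemLp (fun ω => g (ζ ω) (U ω) - h (U ω)) 2 P :=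
  memLp_two_of_lintegral_lt_top
    ((hg.meas.comp (hζ.prodMk hU)).sub (hg.meas_field.comp hU)).aestronglyMeasurable
    ((hg.lintegral_noise_le hU hζ hlaw hind).trans_lt ENNReal.ofReal_lt_top)

theorem integral_noise_sq_le : ∫ ω, ‖g (ζ ω) (U ω) - h (U ω)‖ ^ 2 ∂P ≤ σ ^ 2 := by
  have h1 := hg.lintegral_noise_le hU hζ hlaw hind
  rw [(hg.memLp_noise hU hζ hlaw hind).lintegral_enorm_sq_eq] at h1
  exact (ENNReal.ofReal_le_ofReal_iff (sq_nonneg _)).1 h1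

/-- For frozen `U` the noise has mean zero, so it is orthogonal to every square integrable function
of `U`. -/
theorem integral_inner_noise {z : E → E} (hz : Measurable z) (hz2 : MemLp (fun ω => z (U ω)) 2 P) :
    ∫ ω, inner ℝ (z (U ω)) (g (ζ ω) (U ω) - h (U ω)) ∂P = 0 := by
  have := hg.prob
  have hm : Measurable fun q : E × Ξ => inner ℝ (z q.1) (g q.2 q.1 - h q.1) :=
    (hz.comp measurable_fst).inner
      ((hg.meas.comp measurable_swap).sub (hg.meas_field.comp measurable_fst))
  have hUζ : P.map (fun ω => (U ω, ζ ω)) = (P.map U).prod ν := by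
    rw [hind.map_prod_eq_prod_map_map hU.aemeasurable hζ.aemeasurable, hlaw]
  have hint := hz2.integrable_inner_of_two (hg.memLp_noise hU hζ hlaw hind)
  rw [← integral_map (φ := fun ω => (U ω, ζ ω)) (hU.prodMk hζ).aemeasurable
    (f := fun q : E × Ξ => inner ℝ (z q.1) (g q.2 q.1 - h q.1)) hm.aestronglyMeasurable, hUζ,
    integral_prod]
  · refine integral_eq_zero_of_ae (ae_of_all _ fun x => ?_)
    simp only [Pi.zero_apply]
    refine (integral_inner ((hg.integrable x).sub (integrable_const _)) _).trans ?_
    simp only [Pi.sub_apply]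
    rw [integral_sub (hg.integrable x) (integrable_const _), hg.unbiased]
    simp
  · rw [← hUζ]
    exact (integrable_map_measure hm.aestronglyMeasurable (hU.prodMk hζ).aemeasurable).2 hint

theorem integral_noise : ∫ ω, (g (ζ ω) (U ω) - h (U ω)) ∂P = 0 := by
  refine ext_inner_left ℝ fun c => ?_
  rw [← integral_inner ((hg.memLp_noise hU hζ hlaw hind).integrable one_le_two), inner_zero_right]
  exact hg.integral_inner_noise hU hζ hlaw hind (z := fun _ => c) measurable_const (memLp_const c)

variable {L ρ η : ℝ} (hU2 : MemLp U 2 P) (hlip : ∀ x y, ‖h x - h y‖ ≤ L * ‖x - y‖)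

include hU2 hlip

omit hg hζ hlaw hind in
theorem _root_.memLp_two_comp_of_lipschitz (hh : Measurable h) : MemLp (fun ω => h (U ω)) 2 P := by
  have h1 : MemLp (fun ω => h (U ω) - h 0) 2 P :=
    hU2.of_le_mul (c := L) ((hh.comp hU).sub_const _).aestronglyMeasurable
      (ae_of_all _ fun ω => by simpa using hlip (U ω) 0)
  refine (memLp_congr_ae (ae_of_all _ fun ω => ?_)).1 (h1.add (memLp_const (h 0)))
  simp

theorem memLp_step : MemLp (fun ω => U ω - η • g (ζ ω) (U ω)) 2 P := by
  have h1 := (hU2.sub ((memLp_two_comp_of_lipschitz hU hU2 hlip hg.meas_field).const_smul η)).sub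
    ((hg.memLp_noise hU hζ hlaw hind).const_smul η)
  refine (memLp_congr_ae (ae_of_all _ fun ω => ?_)).1 h1
  simp [smul_sub]

theorem integral_step :
    ∫ ω, (U ω - η • g (ζ ω) (U ω)) ∂P = ∫ ω, (U ω - η • h (U ω)) ∂P := by
  have h0 : MemLp (fun ω => U ω - η • h (U ω)) 2 P :=
    hU2.sub ((memLp_two_comp_of_lipschitz hU hU2 hlip hg.meas_field).const_smul η)
  have h1 := (hg.memLp_noise hU hζ hlaw hind).const_smul η
  have h2 := integral_sub (h0.integrable one_le_two) (h1.integrable one_le_two)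
  simp only [Pi.smul_apply, integral_smul, hg.integral_noise hU hζ hlaw hind, smul_zero,
    sub_zero] at h2
  rw [← h2]
  congr 1 with ω
  rw [smul_sub]; abel

/-- One stochastic gradient step increases the variance by at most `η ^ 2 σ ^ 2`. -/
theorem variance_step_le (hcontr : ∀ x y, ‖(x - η • h x) - (y - η • h y)‖ ≤ ‖x - y‖) :
    ∫ ω, ‖(U ω - η • g (ζ ω) (U ω)) - ∫ ω', (U ω' - η • g (ζ ω') (U ω')) ∂P‖ ^ 2 ∂P ≤
      ∫ ω, ‖U ω - P[U]‖ ^ 2 ∂P + η ^ 2 * σ ^ 2 := by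
  have h0 : MemLp (fun ω => U ω - η • h (U ω)) 2 P :=
    hU2.sub ((memLp_two_comp_of_lipschitz hU hU2 hlip hg.meas_field).const_smul η)
  rw [hg.integral_step hU hζ hlaw hind hU2 hlip]
  set M : E := ∫ ω, (U ω - η • h (U ω)) ∂P with hM
  have hΦ : Measurable fun x => x - η • h x := measurable_id.sub (hg.meas_field.const_smul η)
  have hX : MemLp (fun ω => U ω - η • h (U ω) - M) 2 P := h0.sub (memLp_const M)
  have hY := (hg.memLp_noise hU hζ hlaw hind).const_smul (-η)
  have h3 := integral_norm_add_sq_of_integral_inner_eq_zero hX hY (by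
    simp only [Pi.smul_apply, inner_smul_right, integral_const_mul]
    rw [hg.integral_inner_noise hU hζ hlaw hind (z := fun x => x - η • h x - M)
      (hΦ.sub_const M) hX, mul_zero])
  have e : ∀ ω, (U ω - η • g (ζ ω) (U ω)) - M =
      (U ω - η • h (U ω) - M) + (-η) • (g (ζ ω) (U ω) - h (U ω)) := fun ω => by
    rw [smul_sub, neg_smul, neg_smul]; abel
  simp_rw [e]
  simp only [Pi.smul_apply] at h3
  rw [h3]
  refine add_le_add ?_ ?_
  -- The variance is at most the second moment about any point; about the image of `P[U]` under the
  -- exact step, nonexpansiveness applies pointwise.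
  · refine (integral_norm_sub_integral_sq_le h0 (P[U] - η • h (P[U]))).trans ?_
    refine integral_mono_of_nonneg (ae_of_all _ fun _ => by positivity)
      ((memLp_two_iff_integrable_sq_norm (hU2.sub (memLp_const _)).1).1
        (hU2.sub (memLp_const _))) (ae_of_all _ fun ω => ?_)
    exact pow_le_pow_left₀ (norm_nonneg _) (hcontr _ _) 2
  · simp only [norm_smul, mul_pow, norm_neg, Real.norm_eq_abs, sq_abs]
    rw [integral_const_mul]
    gcongr
    exact hg.integral_noise_sq_le hU hζ hlaw hind

/-- One stochastic gradient step contracts the distance of the mean from a zero of the field, up to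
the nonlinearity of the field, which is controlled by the variance. -/
theorem norm_integral_step_sub_le (hη : 0 ≤ η) (hL : 0 ≤ L)
    (hcontr : ∀ x y, ‖(x - η • h x) - (y - η • h y)‖ ≤ ρ * ‖x - y‖) {y : E} (hy : h y = 0) {v : ℝ}
    (hv : 0 ≤ v) (hvar : ∫ ω, ‖U ω - P[U]‖ ^ 2 ∂P ≤ v ^ 2) :
    ‖∫ ω, (U ω - η • g (ζ ω) (U ω)) ∂P - y‖ ≤ ρ * ‖P[U] - y‖ + η * L * v := by
  rw [hg.integral_step hU hζ hlaw hind hU2 hlip]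
  have hh := memLp_two_comp_of_lipschitz hU hU2 hlip hg.meas_field
  have hD : MemLp (fun ω => h (U ω) - h (P[U])) 2 P := hh.sub (memLp_const _)
  -- The failure of `h` to commute with the mean is at most `L` times the standard deviation of `U`,
  -- by Jensen.
  have h1 : ‖∫ ω, (h (U ω) - h (P[U])) ∂P‖ ≤ L * v := by
    refine le_of_sq_le_sq ((norm_integral_sq_le hD).trans ?_) (by positivity)
    calc _ ≤ ∫ ω, L ^ 2 * ‖U ω - P[U]‖ ^ 2 ∂P := by
          refine integral_mono_of_nonneg (ae_of_all _ fun _ => by positivity)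
            (((memLp_two_iff_integrable_sq_norm (hU2.sub (memLp_const _)).1).1
              (hU2.sub (memLp_const _))).const_mul _) (ae_of_all _ fun ω => ?_)
          simp only [← mul_pow]
          exact pow_le_pow_left₀ (norm_nonneg _) (hlip _ _) 2
      _ = L ^ 2 * ∫ ω, ‖U ω - P[U]‖ ^ 2 ∂P := integral_const_mul _ _
      _ ≤ L ^ 2 * v ^ 2 := by gcongr
      _ = _ := by ring
  have h2 := hcontr (P[U]) y
  rw [hy, smul_zero, sub_zero] at h2
  have e : ∫ ω, (U ω - η • h (U ω)) ∂P - y =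
      (P[U] - η • h (P[U]) - y) - η • ∫ ω, (h (U ω) - h (P[U])) ∂P := by
    have e1 : ∫ ω, (U ω - η • h (U ω)) ∂P = P[U] - ∫ ω, η • h (U ω) ∂P :=
      integral_sub (hU2.integrable one_le_two) ((hh.const_smul η).integrable one_le_two)
    rw [e1, integral_smul, integral_sub (hh.integrable one_le_two) (integrable_const _)]
    simp [smul_sub]
    abel
  rw [e]
  refine (norm_sub_le _ _).trans (add_le_add h2 ?_)
  rw [norm_smul, Real.norm_of_nonneg hη, mul_assoc]
  gcongr

end IsUnbiasedOracle

end StochasticStep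

/-- The noise is bounded around the client's gradient, which may differ from the mean `∇F`; the
second moment is smallest about the mean, so the same `σ²` bounds the variance. -/
theorem FederatedERM.IsStochasticGradient.isUnbiasedOracle {d p m s r : ℕ}
    {Q : FederatedERM d p m s r} {Ξ : Type*} [MeasurableSpace Ξ] {ν : Fin m → Measure Ξ}
    {G : Fin m → Ξ → Param p → Param p} {σ L : ℝ} (hG : Q.IsStochasticGradient ν G σ)
    (hlip : ∀ x y, ‖∇ Q.risk x - ∇ Q.risk y‖ ≤ L * ‖x - y‖) (c : Fin m) :
    IsUnbiasedOracle (ν c) (G c) (∇ Q.risk) σ where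
  prob := hG.prob c
  meas := hG.meas c
  meas_field := by
    refine (LipschitzWith.of_dist_le_mul (K := L.toNNReal) fun x y => ?_).continuous.measurable
    rw [dist_eq_norm, dist_eq_norm]
    exact (hlip x y).trans (by gcongr; exact Real.le_coe_toNNReal L)
  integrable := hG.integrable c
  unbiased := hG.unbiased c
  variance_le := fun x => by
    have := hG.prob c
    have h1 : MemLp (fun ζ => G c ζ x - Q.clientGradient c x) 2 (ν c) :=
      memLp_two_of_lintegral_lt_top
        ((hG.integrable c x).1.sub aestronglyMeasurable_const)
        ((hG.variance_le c x).trans_lt ENNReal.ofReal_lt_top)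
    have h2 : MemLp (fun ζ => G c ζ x) 2 (ν c) := by
      refine (memLp_congr_ae (ae_of_all _ fun ω => ?_)).1
        (h1.add (memLp_const (Q.clientGradient c x)))
      simp
    have h3 := integral_norm_sub_integral_sq_le h2 (Q.clientGradient c x)
    rw [hG.unbiased c x] at h3
    have h4 : MemLp (fun ζ => G c ζ x - ∇ Q.risk x) 2 (ν c) := h2.sub (memLp_const _)
    rw [h4.lintegral_enorm_sq_eq]
    refine (ENNReal.ofReal_le_ofReal h3).trans ?_
    rw [← h1.lintegral_enorm_sq_eq]
    exact hG.variance_le c x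

/-! ### Local SGD of one client -/

section LocalSGD

variable {p : ℕ} {Ξ : Type*} [MeasurableSpace Ξ]

theorem measurable_localSGD {α : Type*} {mα : MeasurableSpace α} {g : Ξ → Param p → Param p}
    (hg : Measurable fun z : Ξ × Param p => g z.1 z.2) (η : ℝ) {x : α → Param p}
    (hx : Measurable x) {ζ : ℕ → α → Ξ} {t : ℕ} (hζ : ∀ s < t, Measurable (ζ s)) :
    Measurable fun a => localSGD g η (fun s => ζ s a) (x a) t := by
  induction t with
  | zero => exact hx
  | succ t ih =>
    have h := ih fun s hs => hζ s (hs.trans t.lt_succ_self)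
    exact h.sub ((hg.comp ((hζ t t.lt_succ_self).prodMk h)).const_smul η)

variable {Ω : Type*} [MeasurableSpace Ω] {P : Measure Ω} [IsProbabilityMeasure P]
  {ν : Measure Ξ} {g : Ξ → Param p → Param p} {h : Param p → Param p} {σ η L ρ : ℝ}
  {ζ : ℕ → Ω → Ξ} {θ : Param p}

theorem localSGD_variance_le (hg : IsUnbiasedOracle ν g h σ) (hζ : ∀ t, Measurable (ζ t))
    (hlaw : ∀ t, P.map (ζ t) = ν)
    (hind : ∀ t, IndepFun (fun ω => localSGD g η (fun s => ζ s ω) θ t) (ζ t) P)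
    (hlip : ∀ x y, ‖h x - h y‖ ≤ L * ‖x - y‖)
    (hcontr : ∀ x y, ‖(x - η • h x) - (y - η • h y)‖ ≤ ‖x - y‖) (t : ℕ) :
    MemLp (fun ω => localSGD g η (fun s => ζ s ω) θ t) 2 P ∧
      ∫ ω, ‖localSGD g η (fun s => ζ s ω) θ t -
        ∫ ω', localSGD g η (fun s => ζ s ω') θ t ∂P‖ ^ 2 ∂P ≤ t * (η ^ 2 * σ ^ 2) := by
  induction t with
  | zero => exact ⟨memLp_const θ, by simp [localSGD]⟩
  | succ t ih =>
    have hU := measurable_localSGD (t := t) hg.meas η (measurable_const (a := θ)) fun s _ => hζ s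
    refine ⟨hg.memLp_step hU (hζ t) (hlaw t) (hind t) ih.1 hlip, ?_⟩
    refine (hg.variance_step_le hU (hζ t) (hlaw t) (hind t) ih.1 hlip hcontr).trans ?_
    push_cast
    linarith [ih.2]

/-- The bias added per step is bounded uniformly over the `b` steps and, by `hB`, is at most `(1 -
ρ)B`. The convex combination form is what allows squaring by convexity later. -/
theorem norm_integral_localSGD_sub_le (hg : IsUnbiasedOracle ν g h σ)
    (hζ : ∀ t, Measurable (ζ t)) (hlaw : ∀ t, P.map (ζ t) = ν)
    (hind : ∀ t, IndepFun (fun ω => localSGD g η (fun s => ζ s ω) θ t) (ζ t) P)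
    (hlip : ∀ x y, ‖h x - h y‖ ≤ L * ‖x - y‖)
    (hη : 0 ≤ η) (hL : 0 ≤ L) (hσ : 0 ≤ σ) (hρ0 : 0 ≤ ρ) (hρ1 : ρ ≤ 1)
    (hcontr : ∀ x y, ‖(x - η • h x) - (y - η • h y)‖ ≤ ρ * ‖x - y‖)
    {y : Param p} (hy : h y = 0) {b : ℕ} {B : ℝ}
    (hB : η * L * (η * √b * σ) ≤ (1 - ρ) * B) {t : ℕ} (ht : t ≤ b) :
    ‖∫ ω, localSGD g η (fun s => ζ s ω) θ t ∂P - y‖ ≤ ρ ^ t * ‖θ - y‖ + (1 - ρ ^ t) * B := by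
  induction t with
  | zero => simp [localSGD]
  | succ t ih =>
    have hU := measurable_localSGD (t := t) hg.meas η (measurable_const (a := θ)) fun s _ => hζ s
    obtain ⟨h1, h2⟩ := localSGD_variance_le hg hζ hlaw hind hlip
      (fun x y => (hcontr x y).trans (mul_le_of_le_one_left (norm_nonneg _) hρ1)) t
    have h3 := hg.norm_integral_step_sub_le hU (hζ t) (hlaw t) (hind t) h1 hlip hη hL hcontr hy
      (v := η * √b * σ) (by positivity) (h2.trans (by
        rw [mul_pow, mul_pow, Real.sq_sqrt (Nat.cast_nonneg b)]
        have : (t : ℝ) ≤ b := by exact_mod_cast (Nat.le_of_succ_le ht)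
        nlinarith [mul_le_mul_of_nonneg_right this (show 0 ≤ η ^ 2 * σ ^ 2 by positivity)]))
    refine h3.trans ?_
    have h4 := mul_le_mul_of_nonneg_left (ih (Nat.le_of_succ_le ht)) hρ0
    rw [pow_succ]
    linarith

end LocalSGD

/-- The mean of the average stays in the ball of radius `R` by convexity; independence removes the
covariances. -/
theorem integral_norm_average_sub_sq_le {Ω E ι : Type*} [MeasurableSpace Ω] {P : Measure Ω}
    [IsProbabilityMeasure P] [NormedAddCommGroup E] [InnerProductSpace ℝ E] [CompleteSpace E]
    [MeasurableSpace E] [BorelSpace E] {A : Finset ι} {K : ℕ} (hA : A.card = K) (hK : 0 < K)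
    {u : ι → Ω → E} (hu : ∀ c ∈ A, MemLp (u c) 2 P)
    (hind : ∀ c ∈ A, ∀ c' ∈ A, c ≠ c' → IndepFun (u c) (u c') P) {y : E} {R V : ℝ}
    (hR : ∀ c ∈ A, ‖P[u c] - y‖ ≤ R) (hV : ∀ c ∈ A, ∫ ω, ‖u c ω - P[u c]‖ ^ 2 ∂P ≤ V) :
    MemLp (fun ω => (1 / (K : ℝ)) • ∑ c ∈ A, u c ω) 2 P ∧
      ∫ ω, ‖(1 / (K : ℝ)) • ∑ c ∈ A, u c ω - y‖ ^ 2 ∂P ≤ R ^ 2 + V / K := by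
  have hK' : (0 : ℝ) < K := by exact_mod_cast hK
  have hm : MemLp (fun ω => (1 / (K : ℝ)) • ∑ c ∈ A, u c ω) 2 P :=
    (memLp_finsetSum A hu).const_smul (1 / (K : ℝ))
  have hmean : ∫ ω, (1 / (K : ℝ)) • ∑ c ∈ A, u c ω ∂P = (1 / (K : ℝ)) • ∑ c ∈ A, P[u c] := by
    rw [integral_smul, integral_finsetSum _ fun c hc => (hu c hc).integrable one_le_two]
  refine ⟨hm, ?_⟩
  rw [integral_norm_sub_sq_eq hm y, hmean, add_comm]
  refine add_le_add ?_ ?_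
  · refine pow_le_pow_left₀ (norm_nonneg _) ?_ 2
    have e : (1 / (K : ℝ)) • ∑ c ∈ A, P[u c] - y = (1 / (K : ℝ)) • ∑ c ∈ A, (P[u c] - y) := by
      rw [Finset.sum_sub_distrib, smul_sub, Finset.sum_const, hA, ← Nat.cast_smul_eq_nsmul ℝ,
        smul_smul, one_div_mul_cancel hK'.ne', one_smul]
    rw [e, norm_smul, Real.norm_of_nonneg (by positivity), one_div, inv_mul_le_iff₀ hK']
    calc _ ≤ ∑ c ∈ A, R := norm_sum_le_of_le _ hR
      _ = K * R := by simp [hA]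
  · simp_rw [← smul_sub, ← Finset.sum_sub_distrib, norm_smul, mul_pow]
    rw [integral_const_mul, integral_norm_sum_sq_of_pairwise A
      (X := fun c ω => u c ω - P[u c]) (fun c hc => (hu c hc).sub (memLp_const _))]
    · calc _ ≤ ‖1 / (K : ℝ)‖ ^ 2 * ∑ c ∈ A, V := by gcongr with c hc; exact hV c hc
        _ = V / K := by
          rw [Real.norm_of_nonneg (by positivity)]
          simp only [Finset.sum_const, hA, nsmul_eq_mul]
          field_simp
    · intro c hc c' hc' hne
      have hi := (hind c hc c' hc' hne).comp (measurable_id.sub_const (P[u c]))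
        (measurable_id.sub_const (P[u c']))
      have h1 := (hu c hc).integrable one_le_two
      have h2 := (hu c' hc').integrable one_le_two
      have := hi.integral_bilin (h1.sub (integrable_const _)) (h2.sub (integrable_const _))
        (innerSL ℝ)
      refine this.trans ?_
      simp only [Function.comp_apply, id]
      rw [integral_sub h1 (integrable_const _)]
      simp

/-! ### Independence of the random choices -/

section Randomness

variable {m K : ℕ} {Ξ : Type*} [MeasurableSpace Ξ] {Ω : Type*}

/-- The `σ`-algebras generated by the individual random choices of federated averaging. -/
abbrev choiceSigma (S : ℕ → Ω → Finset (Fin m)) (ξ : ℕ → Fin m → ℕ → Ω → Ξ)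
    (i : ℕ ⊕ (ℕ × Fin m × ℕ)) : MeasurableSpace Ω :=
  match i with
  | .inl k => MeasurableSpace.comap (S k) ⊤
  | .inr (k, c, t) => MeasurableSpace.comap (ξ k c t) inferInstance

/-- The `σ`-algebra generated by the random choices with index in `I`. -/
abbrev choicesSigma (S : ℕ → Ω → Finset (Fin m)) (ξ : ℕ → Fin m → ℕ → Ω → Ξ)
    (I : Set (ℕ ⊕ (ℕ × Fin m × ℕ))) : MeasurableSpace Ω :=
  ⨆ i ∈ I, choiceSigma S ξ i

variable {S : ℕ → Ω → Finset (Fin m)} {ξ : ℕ → Fin m → ℕ → Ω → Ξ}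
  {I J : Set (ℕ ⊕ (ℕ × Fin m × ℕ))}

theorem choicesSigma_mono (h : I ⊆ J) : choicesSigma S ξ I ≤ choicesSigma S ξ J :=
  biSup_mono h

theorem measurable_sample {k : ℕ} {c : Fin m} {t : ℕ} (h : Sum.inr (k, c, t) ∈ I) :
    Measurable[choicesSigma S ξ I] (ξ k c t) :=
  measurable_iff_comap_le.2 (le_biSup (choiceSigma S ξ) h)

theorem measurable_active {k : ℕ} (h : Sum.inl k ∈ I) :
    Measurable[choicesSigma S ξ I] (S k) :=
  measurable_iff_comap_le.2
    ((MeasurableSpace.comap_mono le_top).trans (le_biSup (choiceSigma S ξ) h))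

variable [mΩ : MeasurableSpace Ω] {P : Measure Ω} {ν : Fin m → Measure Ξ}

namespace IsFedAveRandomness

variable (hr : IsFedAveRandomness K ν P S ξ)

include hr

theorem choiceSigma_le (i : ℕ ⊕ (ℕ × Fin m × ℕ)) : choiceSigma S ξ i ≤ mΩ := by
  match i with
  | .inl k =>
    rintro _ ⟨B, -, rfl⟩
    have : S k ⁻¹' B = ⋃ A ∈ B, {ω | S k ω = A} := by ext; simp
    rw [this]
    exact MeasurableSet.biUnion B.to_countable fun A _ => hr.meas_active k A
  | .inr (k, c, t) => exact measurable_iff_comap_le.1 (hr.meas_sample k c t)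

theorem choicesSigma_le : choicesSigma S ξ I ≤ mΩ :=
  iSup₂_le fun i _ => hr.choiceSigma_le i

/-- Disjoint groups of choices generate independent σ-algebras, so each independence claim reduces
to disjointness of index sets. -/
theorem indepFun (hIJ : Disjoint I J) {α β : Type*} [MeasurableSpace α] [MeasurableSpace β]
    {X : Ω → α} {Y : Ω → β} (hX : Measurable[choicesSigma S ξ I] X)
    (hY : Measurable[choicesSigma S ξ J] Y) : IndepFun X Y P := by
  have h : Indep (choicesSigma S ξ I) (choicesSigma S ξ J) P :=
    indep_iSup_of_disjoint hr.choiceSigma_le hr.indep hIJ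
  exact (IndepFun_iff_Indep X Y P).2 (indep_of_indep_of_le_left
    (indep_of_indep_of_le_right h (measurable_iff_comap_le.1 hY)) (measurable_iff_comap_le.1 hX))

theorem ae_card_active (k : ℕ) : ∀ᵐ ω ∂P, (S k ω).card = K := by
  have h : ∀ A : Finset (Fin m), A.card ≠ K → ∀ᵐ ω ∂P, S k ω ≠ A := fun A hA => by
    rw [ae_iff]
    simpa [hA] using hr.law_active k A
  have h2 : ∀ᵐ ω ∂P, ∀ A : Finset (Fin m), A.card ≠ K → S k ω ≠ A :=
    ae_all_iff.2 fun A => by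
      by_cases hA : A.card ≠ K
      · filter_upwards [h A hA] with ω hω _ using hω
      · exact ae_of_all _ fun _ h => absurd h hA
  filter_upwards [h2] with ω hω
  by_contra hne
  exact hω _ hne rfl

end IsFedAveRandomness

end Randomness

/-! ### One epoch of federated averaging -/

section Epoch

variable {m K p : ℕ} {Ξ : Type*} [MeasurableSpace Ξ] {Ω : Type*}
  {S : ℕ → Ω → Finset (Fin m)} {ξ : ℕ → Fin m → ℕ → Ω → Ξ}
  {G : Fin m → Ξ → Param p → Param p}

/-- The parameter after one epoch from `θ` with active clients `A` and samples `z`. -/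
def epochUpdate (G : Fin m → Ξ → Param p → Param p) (K b : ℕ) (η : ℝ) (A : Finset (Fin m))
    (θ : Param p) (z : Fin m → ℕ → Ξ) : Param p :=
  θ + (1 / (K : ℝ)) • ∑ c ∈ A, (localSGD (G c) η (z c) θ b - θ)

theorem measurable_epochUpdate (hG : ∀ c, Measurable (fun z : Ξ × Param p => G c z.1 z.2))
    (K b : ℕ) (η : ℝ) :
    Measurable fun q : (Param p × Finset (Fin m)) × (Fin m → ℕ → Ξ) =>
      epochUpdate G K b η q.1.2 q.1.1 q.2 := by
  classical
  -- Writing the sum over the random set as a sum over all clients with indicators makes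
  -- measurability termwise.
  have e : ∀ q : (Param p × Finset (Fin m)) × (Fin m → ℕ → Ξ), epochUpdate G K b η q.1.2 q.1.1 q.2 =
      q.1.1 + (1 / (K : ℝ)) • ∑ c, if c ∈ q.1.2 then
        (localSGD (G c) η (q.2 c) q.1.1 b - q.1.1) else 0 := fun q => by
    rw [epochUpdate, Finset.sum_ite_mem, Finset.univ_inter]
  simp_rw [e]
  have hθ : Measurable fun q : (Param p × Finset (Fin m)) × (Fin m → ℕ → Ξ) => q.1.1 :=
    measurable_fst.comp measurable_fst
  refine hθ.add (Measurable.fun_const_smul (Finset.measurable_fun_sum _ fun c _ => ?_) _)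
  refine Measurable.ite ?_ ?_ measurable_const
  · exact (measurable_snd.comp measurable_fst) (measurableSet_mem_finset c)
  · refine (measurable_localSGD (hG c) η hθ
      (ζ := fun t (q : (Param p × Finset (Fin m)) × (Fin m → ℕ → Ξ)) => q.2 c t)
      fun t _ => ?_).sub hθ
    exact (measurable_pi_apply t).comp ((measurable_pi_apply c).comp measurable_snd)

/-- The indices of the random choices made before epoch `k`. -/
def pastChoices (m k : ℕ) : Set (ℕ ⊕ (ℕ × Fin m × ℕ)) :=
  {i | match i with
    | .inl j => j < k
    | .inr (j, _, _) => j < k}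

theorem pastChoices_mono {k l : ℕ} (h : k ≤ l) : pastChoices m k ⊆ pastChoices m l := by
  rintro (j | ⟨j, c, t⟩) hj
  · exact lt_of_lt_of_le (show j < k from hj) h
  · exact lt_of_lt_of_le (show j < k from hj) h

/-- Adaptedness: it makes the samples of epoch `k` independent of the parameter at its start. -/
theorem measurable_fedAve (hG : ∀ c, Measurable (fun z : Ξ × Param p => G c z.1 z.2))
    (b : ℕ) (η : ℕ → ℝ) (θ₀ : Param p) (k : ℕ) :
    Measurable[choicesSigma S ξ (pastChoices m k)] fun ω => fedAve G K b η θ₀ S ξ ω k := by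
  induction k with
  | zero => exact @measurable_const _ _ _ _ θ₀
  | succ k ih =>
    let _ := choicesSigma S ξ (pastChoices m (k + 1))
    have h1 : Measurable fun ω => fedAve G K b η θ₀ S ξ ω k :=
      ih.mono (choicesSigma_mono (pastChoices_mono k.le_succ)) le_rfl
    have h2 : Measurable (S k) := measurable_active (show k < k + 1 from k.lt_succ_self)
    have h3 : Measurable fun ω c t => ξ k c t ω :=
      measurable_pi_lambda _ fun c => measurable_pi_lambda _ fun t =>
        measurable_sample (show k < k + 1 from k.lt_succ_self)
    exact (measurable_epochUpdate hG K b (η k)).comp ((h1.prodMk h2).prodMk h3)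

variable [mΩ : MeasurableSpace Ω] {P : Measure Ω} [IsProbabilityMeasure P] {ν : Fin m → Measure Ξ}
  {h : Param p → Param p} {σ L ρ B : ℝ} {y : Param p}

theorem lintegral_epochUpdate_le (hr : IsFedAveRandomness K ν P S ξ) (hK : 0 < K)
    (hG : ∀ c, IsUnbiasedOracle (ν c) (G c) h σ) (hlip : ∀ x y, ‖h x - h y‖ ≤ L * ‖x - y‖)
    (hL : 0 ≤ L) (hσ : 0 ≤ σ) (hρ0 : 0 ≤ ρ) (hρ1 : ρ ≤ 1) {η : ℝ} (hη : 0 ≤ η)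
    (hcontr : ∀ x y, ‖(x - η • h x) - (y - η • h y)‖ ≤ ρ * ‖x - y‖) (hy : h y = 0) {b : ℕ}
    (hB : η * L * (η * √b * σ) ≤ (1 - ρ) * B) (k : ℕ) {A : Finset (Fin m)} (hA : A.card = K)
    (θ : Param p) :
    ∫⁻ ω, ‖epochUpdate G K b η A θ (fun c t => ξ k c t ω) - y‖ₑ ^ 2 ∂P ≤
      ENNReal.ofReal (ρ ^ b) * ‖θ - y‖ₑ ^ 2 +
        ENNReal.ofReal ((1 - ρ ^ b) * B ^ 2 + b * (η ^ 2 * σ ^ 2) / K) := by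
  set u : Fin m → Ω → Param p := fun c ω => localSGD (G c) η (fun t => ξ k c t ω) θ b with hu
  have hind : ∀ c t, IndepFun (fun ω => localSGD (G c) η (fun s => ξ k c s ω) θ t) (ξ k c t) P := by
    intro c t
    refine hr.indepFun (I := {i | ∃ s < t, i = .inr (k, c, s)}) (J := {.inr (k, c, t)}) ?_ ?_ ?_
    · rw [Set.disjoint_singleton_right]
      rintro ⟨s, hs, he⟩
      simp at he
      omega
    · exact measurable_localSGD (mα := choicesSigma S ξ _) (hG c).meas η
        (@measurable_const _ _ _ (choicesSigma S ξ _) θ) fun s hs => measurable_sample ⟨s, hs, rfl⟩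
    · exact measurable_sample rfl
  have hvar := fun c => localSGD_variance_le (hG c) (hr.meas_sample k c) (hr.law_sample k c)
    (hind c) hlip (fun x y => (hcontr x y).trans (mul_le_of_le_one_left (norm_nonneg _) hρ1)) b
  have hmean := fun c => norm_integral_localSGD_sub_le (hG c) (hr.meas_sample k c)
    (hr.law_sample k c) (hind c) hlip hη hL hσ hρ0 hρ1 hcontr hy hB le_rfl
  obtain ⟨h1, h2⟩ := integral_norm_average_sub_sq_le hA hK (u := u) (fun c _ => (hvar c).1)
    (fun c _ c' _ hne => by
      refine hr.indepFun (I := {i | ∃ s, i = .inr (k, c, s)}) (J := {i | ∃ s, i = .inr (k, c', s)})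
        ?_ ?_ ?_
      · rw [Set.disjoint_left]
        rintro _ ⟨s, rfl⟩ ⟨s', he⟩
        simp at he
        exact hne he.1
      · exact measurable_localSGD (mα := choicesSigma S ξ _) (hG c).meas η
          (@measurable_const _ _ _ (choicesSigma S ξ _) θ) fun s _ => measurable_sample ⟨s, rfl⟩
      · exact measurable_localSGD (mα := choicesSigma S ξ _) (hG c').meas η
          (@measurable_const _ _ _ (choicesSigma S ξ _) θ) fun s _ => measurable_sample ⟨s, rfl⟩)
    (fun c _ => hmean c) (fun c _ => (hvar c).2)
  have hK' : (K : ℝ) ≠ 0 := by exact_mod_cast hK.ne'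
  have e : ∀ ω, epochUpdate G K b η A θ (fun c t => ξ k c t ω) =
      (1 / (K : ℝ)) • ∑ c ∈ A, u c ω := fun ω => by
    rw [epochUpdate, Finset.sum_sub_distrib, smul_sub, Finset.sum_const, hA,
      ← Nat.cast_smul_eq_nsmul ℝ, smul_smul, one_div_mul_cancel hK', one_smul]
    abel
  simp_rw [e]
  have h3 : MemLp (fun ω => (1 / (K : ℝ)) • ∑ c ∈ A, u c ω - y) 2 P := h1.sub (memLp_const y)
  have hq0 : 0 ≤ ρ ^ b := by positivity
  have hq1 : ρ ^ b ≤ 1 := pow_le_one₀ hρ0 hρ1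
  have hq2 : 0 ≤ 1 - ρ ^ b := sub_nonneg.2 hq1
  rw [h3.lintegral_enorm_sq_eq, ← ofReal_norm, ← ENNReal.ofReal_pow (norm_nonneg _),
    ← ENNReal.ofReal_mul hq0, ← ENNReal.ofReal_add (by positivity) (by positivity)]
  refine ENNReal.ofReal_le_ofReal (h2.trans ?_)
  -- With `q = ρ^b` and `a = ‖θ - y‖`, convexity of the square: `q a² + (1-q)B² - (q a + (1-q)B)² =
  -- q(1-q)(a - B)²`.
  nlinarith [mul_nonneg (mul_nonneg hq0 hq2) (sq_nonneg (‖θ - y‖ - B))]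

/-- The fixed-start bound holds for every `θ` and every `A` with `K` elements, so it can be
integrated over the past and the active set. Lower integrals avoid any prior integrability claim. -/
theorem lintegral_fedAve_succ_le (hr : IsFedAveRandomness K ν P S ξ) (hK : 0 < K)
    (hG : ∀ c, IsUnbiasedOracle (ν c) (G c) h σ) (hlip : ∀ x y, ‖h x - h y‖ ≤ L * ‖x - y‖)
    (hL : 0 ≤ L) (hσ : 0 ≤ σ) (hρ0 : 0 ≤ ρ) (hρ1 : ρ ≤ 1) {η : ℕ → ℝ} {k : ℕ} (hη : 0 ≤ η k)
    (hcontr : ∀ x y, ‖(x - η k • h x) - (y - η k • h y)‖ ≤ ρ * ‖x - y‖) (hy : h y = 0) {b : ℕ}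
    (hB : η k * L * (η k * √b * σ) ≤ (1 - ρ) * B) (θ₀ : Param p) :
    ∫⁻ ω, ‖fedAve G K b η θ₀ S ξ ω (k + 1) - y‖ₑ ^ 2 ∂P ≤
      ENNReal.ofReal (ρ ^ b) * ∫⁻ ω, ‖fedAve G K b η θ₀ S ξ ω k - y‖ₑ ^ 2 ∂P +
        ENNReal.ofReal ((1 - ρ ^ b) * B ^ 2 + b * (η k ^ 2 * σ ^ 2) / K) := by
  have hGm := fun c => (hG c).meas
  have hf : Measurable fun q : (Param p × Finset (Fin m)) × (Fin m → ℕ → Ξ) =>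
      ‖epochUpdate G K b (η k) q.1.2 q.1.1 q.2 - y‖ₑ ^ 2 :=
    ((measurable_epochUpdate hGm K b (η k)).sub_const y).enorm.pow_const 2
  have hθ : Measurable[choicesSigma S ξ (pastChoices m k ∪ {.inl k})]
      fun ω => fedAve G K b η θ₀ S ξ ω k :=
    (measurable_fedAve hGm b η θ₀ k).mono (choicesSigma_mono Set.subset_union_left) le_rfl
  have hX : Measurable[choicesSigma S ξ (pastChoices m k ∪ {.inl k})]
      fun ω => (fedAve G K b η θ₀ S ξ ω k, S k ω) :=
    hθ.prodMk (measurable_active (Or.inr rfl))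
  have hY : Measurable[choicesSigma S ξ {i | ∃ c t, i = .inr (k, c, t)}]
      fun ω c t => ξ k c t ω :=
    @measurable_pi_lambda _ _ _ (choicesSigma S ξ _) _ _ fun c =>
      @measurable_pi_lambda _ _ _ (choicesSigma S ξ _) _ _ fun t =>
        measurable_sample ⟨c, t, rfl⟩
  have hind : IndepFun (fun ω => (fedAve G K b η θ₀ S ξ ω k, S k ω)) (fun ω c t => ξ k c t ω) P := by
    refine hr.indepFun ?_ hX hY
    rw [Set.disjoint_left]
    rintro _ h1 ⟨c, t, rfl⟩
    rcases h1 with h1 | h1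
    · exact lt_irrefl k h1
    · simp at h1
  have h1 := hind.lintegral_comp_prodMk (hX.mono hr.choicesSigma_le le_rfl)
    (hY.mono hr.choicesSigma_le le_rfl) hf
  refine (le_of_eq h1).trans ?_
  have hθm : Measurable fun ω => ‖fedAve G K b η θ₀ S ξ ω k - y‖ₑ ^ 2 :=
    ((hθ.mono hr.choicesSigma_le le_rfl).sub_const y).enorm.pow_const 2
  calc _ ≤ ∫⁻ ω, (ENNReal.ofReal (ρ ^ b) * ‖fedAve G K b η θ₀ S ξ ω k - y‖ₑ ^ 2 +
        ENNReal.ofReal ((1 - ρ ^ b) * B ^ 2 + b * (η k ^ 2 * σ ^ 2) / K)) ∂P := by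
        refine lintegral_mono_ae ?_
        filter_upwards [hr.ae_card_active k] with ω hω
        exact lintegral_epochUpdate_le hr hK hG hlip hL hσ hρ0 hρ1 hη hcontr hy hB k hω _
    _ = _ := by
      rw [lintegral_add_right _ measurable_const, lintegral_const_mul _ hθm]
      simp

end Epoch

/-! ### The scalar recursion and its error terms -/

section Rates

/-- `(1-x)^b ≤ exp(-xb) ≤ 1/(1 + 3/(k+1))`. The 3 is the step constant 4 times the contraction
constant 3/4; it yields cubic decay of the initial error. -/
theorem one_sub_pow_le_div {x : ℝ} {b k : ℕ} (hx : x ≤ 1)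
    (hxb : 3 / ((k : ℝ) + 1) ≤ x * b) : (1 - x) ^ b ≤ ((k : ℝ) + 1) / (k + 4) := by
  have h1 : (1 - x) ^ b ≤ Real.exp (-x) ^ b :=
    pow_le_pow_left₀ (by linarith) (by linarith [Real.add_one_le_exp (-x)]) b
  have h2 : 1 + 3 / ((k : ℝ) + 1) ≤ Real.exp (x * b) := by
    linarith [Real.add_one_le_exp (x * b)]
  have h3 : Real.exp (-x) ^ b = (Real.exp (x * b))⁻¹ := by
    rw [← Real.exp_nat_mul, ← Real.exp_neg]; ring_nf
  rw [h3] at h1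
  refine h1.trans ((inv_anti₀ (by positivity) h2).trans (le_of_eq ?_))
  field_simp
  ring

/-- A recursion with contraction factor `1 - 3 / (k + 4)` and errors of order `k⁻³` and `k⁻²`. -/
theorem le_of_forall_succ_le_mul_add {u : ℕ → ℝ≥0∞} {q e : ℕ → ℝ} {k₀ : ℕ} {D α β : ℝ}
    (hD : 0 ≤ D) (hα : 0 ≤ α) (hβ : 0 ≤ β) (hk₀ : 1 ≤ k₀) (h0 : u k₀ ≤ ENNReal.ofReal D)
    (hu : ∀ k, k₀ ≤ k → u (k + 1) ≤ ENNReal.ofReal (q k) * u k + ENNReal.ofReal (e k))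
    (hq : ∀ k, k₀ ≤ k → q k ≤ ((k : ℝ) + 1) / (k + 4))
    (he : ∀ k, k₀ ≤ k → e k ≤ α / (k : ℝ) ^ 3 + β / (k : ℝ) ^ 2) {k : ℕ} (hk : k₀ ≤ k) :
    u k ≤ ENNReal.ofReal ((((k₀ : ℝ) + 1) * (k₀ + 2) * (k₀ + 3) * D + 60 * (α * k + β * k ^ 2)) /
      (((k : ℝ) + 1) * (k + 2) * (k + 3))) := by
  induction k, hk using Nat.le_induction with
  | base =>
    refine h0.trans (ENNReal.ofReal_le_ofReal ?_)
    rw [le_div_iff₀ (by positivity)]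
    have : 0 ≤ 60 * (α * (k₀ : ℝ) + β * (k₀ : ℝ) ^ 2) := by positivity
    linarith
  | succ k hk ih =>
    set W := ((k₀ : ℝ) + 1) * (k₀ + 2) * (k₀ + 3) * D with hW
    have hW0 : 0 ≤ W := by positivity
    have hk1 : (1 : ℝ) ≤ k := by exact_mod_cast hk₀.trans hk
    have hk0 : (0 : ℝ) < k := by linarith
    calc u (k + 1) ≤ ENNReal.ofReal (q k) * u k + ENNReal.ofReal (e k) := hu k hk
      _ ≤ ENNReal.ofReal (((k : ℝ) + 1) / (k + 4)) *
            ENNReal.ofReal ((W + 60 * (α * k + β * k ^ 2)) /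
              (((k : ℝ) + 1) * (k + 2) * (k + 3))) +
            ENNReal.ofReal (α / (k : ℝ) ^ 3 + β / (k : ℝ) ^ 2) := by
          gcongr
          · exact hq k hk
          · exact he k hk
      _ = ENNReal.ofReal (((k : ℝ) + 1) / (k + 4) * ((W + 60 * (α * k + β * k ^ 2)) /
              (((k : ℝ) + 1) * (k + 2) * (k + 3))) + (α / (k : ℝ) ^ 3 + β / (k : ℝ) ^ 2)) := by
          rw [← ENNReal.ofReal_mul (by positivity),
            ← ENNReal.ofReal_add (by positivity) (by positivity)]
      _ ≤ _ := by
          refine ENNReal.ofReal_le_ofReal ?_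
          push_cast
          rw [le_div_iff₀ (by positivity), add_mul]
          -- The weight `(k+1)(k+2)(k+3)` absorbs the factor `(k+1)/(k+4)` exactly, so the weighted
          -- sequence only accumulates errors.
          have e1 : ((k : ℝ) + 1) / (k + 4) * ((W + 60 * (α * k + β * k ^ 2)) /
              (((k : ℝ) + 1) * (k + 2) * (k + 3))) *
              (((k : ℝ) + 1 + 1) * (k + 1 + 2) * (k + 1 + 3)) =
              W + 60 * (α * k + β * k ^ 2) := by
            field_simp
            ring
          have e2 : ((k : ℝ) + 1 + 1) * (k + 1 + 2) * (k + 1 + 3) ≤ 60 * (k : ℝ) ^ 3 := by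
            calc _ ≤ (3 * (k : ℝ)) * (4 * k) * (5 * k) := by gcongr <;> linarith
              _ = _ := by ring
          have e3 : (α / (k : ℝ) ^ 3 + β / (k : ℝ) ^ 2) *
              (((k : ℝ) + 1 + 1) * (k + 1 + 2) * (k + 1 + 3)) ≤ 60 * (α + β * k) := by
            refine (mul_le_mul_of_nonneg_left e2 (by positivity)).trans (le_of_eq ?_)
            field_simp
          rw [e1]
          nlinarith [mul_nonneg hβ hk0.le]

variable {μ L σ η : ℝ} {k b K : ℕ}

/-- The error that one epoch of federated averaging adds. -/
theorem epoch_error_le (hμ : 0 < μ) (hk : 1 ≤ k) (hb : 1 ≤ b)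
    (hη : η = 4 / (μ * ((k : ℝ) * b + 1))) (hημ : 3 / 4 * (η * μ) ≤ 1) :
    (1 - (1 - 3 / 4 * (η * μ)) ^ b) * (4 * L / (3 * μ) * (η * √b * σ)) ^ 2 +
        b * (η ^ 2 * σ ^ 2) / K ≤
      256 * L ^ 2 / (3 * μ ^ 4) * (σ ^ 2 / b) / (k : ℝ) ^ 3 +
        16 / μ ^ 2 * (σ ^ 2 / (b * K)) / (k : ℝ) ^ 2 := by
  have hk0 : (0 : ℝ) < k := by exact_mod_cast hk
  have hb0 : (0 : ℝ) < b := by exact_mod_cast hb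
  have hη0 : 0 ≤ η := by rw [hη]; positivity
  have hη1 : η ≤ 4 / (μ * (k * b)) := by
    rw [hη]; gcongr; linarith
  -- Bernoulli's inequality. This extra factor of order `1/k` turns the bias from order `k⁻²` into
  -- `k⁻³`.
  have h1 : 1 - (1 - 3 / 4 * (η * μ)) ^ b ≤ 3 / k := by
    have h := one_add_mul_le_pow (a := -(3 / 4 * (η * μ))) (by linarith) b
    have h' : (b : ℝ) * (3 / 4 * (η * μ)) ≤ b * (3 / 4 * (4 / (μ * (k * b)) * μ)) := by gcongr
    have h'' : (b : ℝ) * (3 / 4 * (4 / (μ * (k * b)) * μ)) = 3 / k := by field_simp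
    rw [← sub_eq_add_neg] at h
    linarith
  have h2 : b * η ^ 2 ≤ 16 / (μ ^ 2 * k ^ 2 * b) := by
    calc b * η ^ 2 ≤ b * (4 / (μ * (k * b))) ^ 2 := by gcongr
      _ = _ := by field_simp; ring
  refine add_le_add ?_ ?_
  · calc _ = (1 - (1 - 3 / 4 * (η * μ)) ^ b) * ((4 * L / (3 * μ)) ^ 2 * σ ^ 2 * (b * η ^ 2)) := by
          rw [mul_pow, mul_pow, mul_pow, Real.sq_sqrt hb0.le]; ring
      _ ≤ 3 / k * ((4 * L / (3 * μ)) ^ 2 * σ ^ 2 * (16 / (μ ^ 2 * k ^ 2 * b))) := by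
          gcongr
      _ = _ := by field_simp; ring
  · calc _ = σ ^ 2 / K * (b * η ^ 2) := by ring
      _ ≤ σ ^ 2 / K * (16 / (μ ^ 2 * k ^ 2 * b)) := by gcongr
      _ = _ := by
          rcases eq_or_ne (K : ℝ) 0 with hK | hK
          · simp [hK]
          · field_simp

end Rates

/-! ### From mean squared distance to the convergence rate -/

theorem FederatedERM.isApproxSolution_of_lintegral_le {d p m s r : ℕ}
    {Q : FederatedERM d p m s r} {θstar : Param p} {L v ε : ℝ} {Ω : Type*} [MeasurableSpace Ω]
    {P : Measure Ω} [IsProbabilityMeasure P] {X : Ω → Param p} (hQ : Continuous Q.risk)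
    (hmin : ∀ θ, Q.risk θstar ≤ Q.risk θ) (hL : 0 ≤ L)
    (hup : ∀ θ, Q.risk θ - Q.risk θstar ≤ L * ‖θ - θstar‖ ^ 2) (hX : Measurable X)
    (hv : 0 ≤ v) (hXv : ∫⁻ ω, ‖X ω - θstar‖ₑ ^ 2 ∂P ≤ ENNReal.ofReal v) (hε : L * v ≤ ε) :
    Q.IsApproxSolution θstar ε P X := by
  have h1 : MemLp (fun ω => X ω - θstar) 2 P :=
    memLp_two_of_lintegral_lt_top (hX.sub_const _).aestronglyMeasurable
      (hXv.trans_lt ENNReal.ofReal_lt_top)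
  have h2 := ((memLp_two_iff_integrable_sq_norm h1.1).1 h1).const_mul L
  have h3 : Integrable (fun ω => Q.risk (X ω) - Q.risk θstar) P := by
    refine h2.mono' ((hQ.measurable.comp hX).sub_const _).aestronglyMeasurable
      (ae_of_all _ fun ω => ?_)
    rw [Real.norm_of_nonneg (sub_nonneg.2 (hmin _))]
    exact hup _
  have h4 : Integrable (fun ω => Q.risk (X ω)) P := by
    refine (h3.add (integrable_const (Q.risk θstar))).congr (ae_of_all _ fun ω => ?_)
    simp
  refine ⟨h4, ?_⟩
  rw [h1.lintegral_enorm_sq_eq, ENNReal.ofReal_le_ofReal_iff hv] at hXv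
  calc _ = ∫ ω, (Q.risk (X ω) - Q.risk θstar) ∂P := by
        rw [integral_sub h4 (integrable_const _)]; simp
    _ ≤ ∫ ω, L * ‖X ω - θstar‖ ^ 2 ∂P := integral_mono h3 h2 fun ω => hup _
    _ = L * ∫ ω, ‖X ω - θstar‖ ^ 2 ∂P := integral_const_mul _ _
    _ ≤ L * v := by gcongr
    _ ≤ ε := hε

/-- The rate of convergence of federated averaging for smooth and strongly convex losses. -/
theorem lintegral_fedAve_sub_sq_le {d p m s r K b k₀ T : ℕ} {L μ σ D : ℝ} (hμ : 0 < μ) (hL : μ < L)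
    (hσ : 0 ≤ σ) (hD : 0 ≤ D) (hK : 0 < K) (hb : 1 ≤ b) (hk₀ : 1 ≤ k₀) (hT : k₀ ≤ T)
    (hn : 0 < (m : ℝ) * s + r) {Q : FederatedERM d p m s r} {θstar : Param p}
    (hsmooth : Q.SmoothInParameter L) (hconv : Q.StronglyConvexInParameter μ)
    (hmin : ∀ θ, Q.risk θstar ≤ Q.risk θ)
    {Ξ : Type*} [MeasurableSpace Ξ] {ν : Fin m → Measure Ξ} {G : Fin m → Ξ → Param p → Param p}
    (hG : Q.IsStochasticGradient ν G σ)
    {Ω : Type*} [MeasurableSpace Ω] {P : Measure Ω} [IsProbabilityMeasure P]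
    {S : ℕ → Ω → Finset (Fin m)} {ξ : ℕ → Fin m → ℕ → Ω → Ξ}
    (hr : IsFedAveRandomness K ν P S ξ) {θ₀ : Param p} {η : ℕ → ℝ}
    (hη : ∀ k, k₀ ≤ k → η k = 4 / (μ * ((k : ℝ) * b + 1)))
    (hlarge : 8 * L ^ 2 ≤ μ ^ 2 * (k₀ * b))
    (h0 : ∫⁻ ω, ‖fedAve G K b η θ₀ S ξ ω k₀ - θstar‖ₑ ^ 2 ∂P ≤ ENNReal.ofReal D) :
    ∫⁻ ω, ‖fedAve G K b η θ₀ S ξ ω T - θstar‖ₑ ^ 2 ∂P ≤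
      ENNReal.ofReal (((k₀ : ℝ) + 1) * (k₀ + 2) * (k₀ + 3) * D / (T : ℝ) ^ 3 +
        60 * (256 * L ^ 2 / (3 * μ ^ 4) * (σ ^ 2 / b)) / (T : ℝ) ^ 2 +
        60 * (16 / μ ^ 2 * (σ ^ 2 / (b * K))) / T) := by
  have hL0 : 0 < L := hμ.trans hL
  have hT0 : (0 : ℝ) < T := by exact_mod_cast (Nat.lt_of_lt_of_le hk₀ hT)
  have hb0 : (0 : ℝ) < b := by exact_mod_cast hb
  have hlip := FederatedERM.norm_gradient_risk_sub_le hsmooth hn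
  have hstrong := FederatedERM.stronglyConvex_risk hsmooth hconv hn
  have hmono := stronglyMonotone_of_stronglyConvex hstrong
  have hzero : ∇ Q.risk θstar = 0 := gradient_eq_zero_of_forall_le hmin
  set α := 256 * L ^ 2 / (3 * μ ^ 4) * (σ ^ 2 / b) with hα
  set β := 16 / μ ^ 2 * (σ ^ 2 / (b * K)) with hβ
  have hα0 : 0 ≤ α := by positivity
  have hβ0 : 0 ≤ β := by positivity
  have hηL : ∀ k, k₀ ≤ k → 0 < η k ∧ η k * L ^ 2 ≤ μ / 2 ∧ 3 / 4 * (η k * μ) ≤ 1 := by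
    intro k hk
    have hkb : (k₀ : ℝ) * b ≤ k * b := by gcongr
    have h1 : 0 < η k := by rw [hη k hk]; positivity
    have h2 : η k * L ^ 2 ≤ μ / 2 := by
      rw [hη k hk, div_mul_eq_mul_div, div_le_iff₀ (by positivity)]
      nlinarith [mul_le_mul_of_nonneg_left hkb (sq_nonneg μ), sq_nonneg μ]
    refine ⟨h1, h2, ?_⟩
    have h3 : η k * μ ^ 2 ≤ η k * L ^ 2 := by gcongr
    have h4 : μ * (η k * μ) ≤ μ * (1 / 2) := by nlinarith
    linarith [le_of_mul_le_mul_left h4 hμ]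
  have hmain := le_of_forall_succ_le_mul_add
    (u := fun k => ∫⁻ ω, ‖fedAve G K b η θ₀ S ξ ω k - θstar‖ₑ ^ 2 ∂P)
    (q := fun k => (1 - 3 / 4 * (η k * μ)) ^ b)
    (e := fun k => (1 - (1 - 3 / 4 * (η k * μ)) ^ b) * (4 * L / (3 * μ) * (η k * √b * σ)) ^ 2 +
        b * (η k ^ 2 * σ ^ 2) / K) hD hα0 hβ0 hk₀ h0 ?_ ?_ ?_ hT
  · refine hmain.trans (ENNReal.ofReal_le_ofReal ?_)
    have hW : 0 ≤ ((k₀ : ℝ) + 1) * (k₀ + 2) * (k₀ + 3) * D := by positivity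
    calc _ ≤ (((k₀ : ℝ) + 1) * (k₀ + 2) * (k₀ + 3) * D + 60 * (α * T + β * (T : ℝ) ^ 2)) /
          (T : ℝ) ^ 3 := by
          gcongr
          calc (T : ℝ) ^ 3 = (T : ℝ) * T * T := by ring
            _ ≤ _ := by gcongr <;> linarith
      _ = _ := by field_simp; ring
  · intro k hk
    obtain ⟨h1, h2, h3⟩ := hηL k hk
    -- `B = 4L/(3μ) · η√b σ` solves `ηL · η√b σ = (1 - ρ)B`, since `1 - ρ = 3/4 ημ`.
    refine lintegral_fedAve_succ_le hr hK (fun c => hG.isUnbiasedOracle hlip c) hlip hL0.le hσ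
      (by linarith) (by nlinarith [mul_pos h1 hμ]) h1.le
      (norm_gradientStep_sub_le hμ hL h1.le h2 hlip hmono) hzero (le_of_eq ?_) θ₀
    field_simp
    ring
  · intro k hk
    obtain ⟨h1, h2, h3⟩ := hηL k hk
    refine one_sub_pow_le_div h3 ?_
    rw [hη k hk]
    have hb1 : (1 : ℝ) ≤ b := by exact_mod_cast hb
    have e : 3 / 4 * (4 / (μ * ((k : ℝ) * b + 1)) * μ) * b = 3 * b / (k * b + 1) := by
      field_simp
    rw [e, div_le_div_iff₀ (by positivity) (by positivity)]
    nlinarith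
  · intro k hk
    exact epoch_error_le hμ (hk₀.trans hk) hb (hη k hk) (hηL k hk).2.2

theorem federatedOracleComplexity_const_univ (φ τ : ℝ) (m T b : ℕ) :
    federatedOracleComplexity φ τ m T (fun _ => b) Finset.univ = T * (b + φ * τ * m) := by
  simp [federatedOracleComplexity]
  ring

theorem fedAveComplexity_le {d p m s r : ℕ} {Q : FederatedERM d p m s r} {θstar : Param p}
    {φ τ ε bmax : ℝ} {Ω : Type*} [MeasurableSpace Ω] {P : Measure Ω} {X : ℕ → ℕ → Ω → Param p}
    {b T : ℕ} (hb : 1 ≤ b) (hb' : (b : ℝ) ≤ bmax) (hT : 1 ≤ T)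
    (hX : Q.IsApproxSolution θstar ε P (X b T)) :
    fedAveComplexity Q θstar φ τ ε bmax P X ≤ ENNReal.ofReal (T * (b + φ * τ * m)) := by
  rw [← federatedOracleComplexity_const_univ]
  exact iInf₂_le_of_le b T (iInf_le _ ⟨hb, hb', hT, hX⟩)

end

/-! ### Choice of parameters and the complexity bound -/

/-- Each of the three errors is at most a constant times `p/(A y⁴) = ε/A`, and by `hZ` these
constants sum to at most `A`. -/
theorem rate_le {L w W D a₁ a₂ C v p ε y A T b K κ : ℝ} (hL : 0 ≤ L) (hw : 0 ≤ w) (ha₁ : 0 ≤ a₁)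
    (ha₂ : 0 ≤ a₂) (hv : 0 ≤ v) (hW : w ≤ W) (hD : 0 ≤ D) (hvC : v ≤ C * p) (hε : 0 < ε)
    (hp : 1 ≤ p) (hb : 1 ≤ b) (hκ : 0 < κ) (hA : 0 < A) (hy : p / ε = y ^ 4)
    (hT2 : A * y ^ 4 ≤ T ^ 2) (hT3 : A * y ^ 4 ≤ T ^ 3)
    (hTm : κ * (A * y ^ 4) ≤ b * K * T)
    (hZ : L * (W * D) + L * (60 * a₁ * C) + L * (60 * a₂ * C) * (1 / κ) ≤ A) :
    L * (w * (D * p) / T ^ 3 + 60 * (a₁ * (v / b)) / T ^ 2 + 60 * (a₂ * (v / (b * K))) / T) ≤ ε := by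
  have hp0 : 0 < p := by linarith
  have hy0 : 0 < y ^ 4 := by rw [← hy]; positivity
  have e1 : L * (w * (D * p) / T ^ 3) ≤ L * (W * D) * (p / (A * y ^ 4)) := by
    have hW0 : 0 ≤ W := hw.trans hW
    calc _ ≤ L * (W * (D * p) / (A * y ^ 4)) := by gcongr
      _ = _ := by ring
  have e2 : L * (60 * (a₁ * (v / b)) / T ^ 2) ≤ L * (60 * a₁ * C) * (p / (A * y ^ 4)) := by
    have hCp : 0 ≤ C * p := hv.trans hvC
    calc _ ≤ L * (60 * (a₁ * (C * p / 1)) / (A * y ^ 4)) := by gcongr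
      _ = _ := by ring
  have e3 : L * (60 * (a₂ * (v / (b * K))) / T) ≤
      L * (60 * a₂ * C) * (1 / κ) * (p / (A * y ^ 4)) := by
    have hCp : 0 ≤ C * p := hv.trans hvC
    calc _ = L * (60 * a₂) * (v / (b * K * T)) := by rw [← div_div v]; ring
      _ ≤ L * (60 * a₂) * (C * p / (κ * (A * y ^ 4))) := by gcongr
      _ = _ := by field_simp
  have e4 : A * (p / (A * y ^ 4)) = ε := by
    rw [← hy]; field_simp
  have e5 := mul_le_mul_of_nonneg_right hZ (show 0 ≤ p / (A * y ^ 4) by positivity)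
  rw [mul_add, mul_add]
  linarith

set_option maxHeartbeats 1000000 in
theorem mainTheorem3
    (τ L₁ μ Cσ Cb Cθ c₀ c₁ δ : ℝ)
    (hτ : 0 < τ) (hτ1 : τ ≤ 1) (hμ : 0 < μ) (hL : μ < L₁)
    (hCσ : 0 < Cσ) (hCb : 0 < Cb) (hCθ : 0 < Cθ) (hc₀ : 0 < c₀) (hc₁ : 0 < c₁) (hδ : 0 < δ) :
    ∃ (C φ₀ : ℝ) (m₀ : ℕ), 0 < C ∧ 0 < φ₀ ∧
      ∀ (d p m s r K : ℕ) (φ ε σ : ℝ),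
        1 ≤ p → 1 ≤ s → 1 ≤ m → m₀ ≤ m → (K : ℝ) = τ * m →
        φ₀ ≤ φ → 0 < ε → ε ≤ 1 → δ * ((p : ℝ) / ε) ^ (1 / 8 : ℝ) ≤ m →
        0 < σ → σ ^ 2 ≤ Cσ * p →
      ∀ (Q : FederatedERM d p m s r) (θstar : Param p),
        Q.SmoothInParameter L₁ → Q.StronglyConvexInParameter μ →
        (∀ θ, Q.risk θstar ≤ Q.risk θ) →
      ∀ (Ξ : Type*) [MeasurableSpace Ξ] (ν : Fin m → Measure Ξ)
        (G : Fin m → Ξ → Param p → Param p),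
        Q.IsStochasticGradient ν G σ →
      ∀ (Ω : Type*) [MeasurableSpace Ω] (P : Measure Ω) [IsProbabilityMeasure P]
        (S : ℕ → Ω → Finset (Fin m)) (ξ : ℕ → Fin m → ℕ → Ω → Ξ),
        IsFedAveRandomness K ν P S ξ →
      ∀ (θ₀ : Param p) (η : ℕ → ℕ → ℝ) (T₀ : ℕ → ℕ),
        (∀ b : ℕ, 1 ≤ b → (b : ℝ) ≤ Cb * m →
          c₀ * (m / b) ≤ T₀ b ∧ (T₀ b : ℝ) ≤ c₁ * (m / b) ∧
          (∀ k, T₀ b ≤ k → η b k = 4 / (μ * ((k : ℝ) * b + 1))) ∧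
          ∫⁻ ω, ‖fedAve G K b (η b) θ₀ S ξ ω (T₀ b) - θstar‖ₑ ^ 2 ∂P
            ≤ ENNReal.ofReal (Cθ * p)) →
        fedAveComplexity Q θstar φ τ ε (Cb * m) P
            (fun b T ω => fedAve G K b (η b) θ₀ S ξ ω T)
          ≤ ENNReal.ofReal (C * (φ * m * ((p : ℝ) / ε) ^ (3 / 4 : ℝ))) := by
  have hL0 : 0 < L₁ := hμ.trans hL
  -- `R` bounds `T₀`, because `b ≥ C_b m/2`.
  set R := 2 * c₁ / Cb with hR
  have hR0 : 0 ≤ R := by positivity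
  set Z₁ := L₁ * ((R + 1) * (R + 2) * (R + 3) * Cθ) with hZ₁
  set Z₂ := L₁ * (60 * (256 * L₁ ^ 2 / (3 * μ ^ 4)) * Cσ) with hZ₂
  set Z₃ := L₁ * (60 * (16 / μ ^ 2) * Cσ) * (1 / (Cb * τ * δ ^ 2 / 2)) with hZ₃
  have hZ₁0 : 0 ≤ Z₁ := by positivity
  have hZ₂0 : 0 ≤ Z₂ := by positivity
  have hZ₃0 : 0 ≤ Z₃ := by positivity
  -- The `Z`s are the three error constants; `1 + R` ensures `A ≥ 1` and `T ≥ T₀`.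
  set A := 1 + R + (Z₁ + Z₂ + Z₃) with hA
  have hA1 : 1 ≤ A := by rw [hA]; linarith
  -- The first term gives `C_b m ≥ 1`, hence `b ≥ 1`; the second makes `η_k` small enough for
  -- contraction from `T₀` on.
  obtain ⟨m₀, hm₀⟩ := exists_nat_ge (1 / Cb + 8 * L₁ ^ 2 / (μ ^ 2 * c₀))
  refine ⟨(A + 1) * (Cb + 1), 1, m₀, by positivity, one_pos, ?_⟩
  intro d p m s r K φ ε σ hp hs hm hmm₀ hKτ hφ hε hε1 hmδ hσ hσ2 Q θstar hsmooth hconv hmin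
    Ξ _ ν G hG Ω _ P _ S ξ hr θ₀ η T₀ hT₀
  have hm1 : (1 : ℝ) ≤ m := by exact_mod_cast hm
  have hm0 : (0 : ℝ) < m := by linarith
  have hs1 : (1 : ℝ) ≤ s := by exact_mod_cast hs
  have hp1 : (1 : ℝ) ≤ p := by exact_mod_cast hp
  have hmm : 1 / Cb + 8 * L₁ ^ 2 / (μ ^ 2 * c₀) ≤ m := hm₀.trans (by exact_mod_cast hmm₀)
  have hCbm : 1 ≤ Cb * m := by
    have h1 : 1 / Cb ≤ m := le_trans (le_add_of_nonneg_right (by positivity)) hmm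
    rwa [div_le_iff₀' hCb] at h1
  have hLm : 8 * L₁ ^ 2 ≤ μ ^ 2 * (c₀ * m) := by
    have h1 : 8 * L₁ ^ 2 / (μ ^ 2 * c₀) ≤ m := le_trans (le_add_of_nonneg_left (by positivity)) hmm
    rwa [div_le_iff₀' (by positivity), mul_assoc] at h1
  have hK : 0 < K := by
    have : (0 : ℝ) < K := by rw [hKτ]; positivity
    exact_mod_cast this
  set b := ⌊Cb * m⌋₊ with hb
  have hb1 : 1 ≤ b := Nat.one_le_floor_iff _ |>.2 hCbm
  have hbCb : (b : ℝ) ≤ Cb * m := Nat.floor_le (by positivity)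
  have hb1' : (1 : ℝ) ≤ b := by exact_mod_cast hb1
  have hb2 : Cb * m / 2 ≤ b := by
    have := Nat.lt_floor_add_one (Cb * m)
    rw [← hb] at this
    linarith
  obtain ⟨hT₀l, hT₀u, hη, hinit⟩ := hT₀ b hb1 hbCb
  have hT₀1 : 1 ≤ T₀ b := by
    have : (0 : ℝ) < T₀ b := lt_of_lt_of_le (by positivity) hT₀l
    exact_mod_cast this
  have hT₀R : (T₀ b : ℝ) ≤ R := by
    refine hT₀u.trans ?_
    rw [hR, ← mul_div_assoc, div_le_div_iff₀ (by positivity) hCb]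
    linarith [mul_le_mul_of_nonneg_left hb2 hc₁.le]
  have hT₀b : c₀ * m ≤ T₀ b * b := by
    rwa [← mul_div_assoc, div_le_iff₀ (by positivity)] at hT₀l
  have hpε : 1 ≤ (p : ℝ) / ε := by rw [le_div_iff₀ hε]; linarith
  have hpε0 : 0 ≤ (p : ℝ) / ε := by positivity
  set y := ((p : ℝ) / ε) ^ (1 / 4 : ℝ) with hy
  have hy1 : 1 ≤ y := Real.one_le_rpow hpε (by norm_num)
  have hy0 : 0 < y := by linarith
  have hy3 : ((p : ℝ) / ε) ^ (3 / 4 : ℝ) = y ^ 3 := by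
    rw [hy, ← Real.rpow_natCast, ← Real.rpow_mul hpε0]; norm_num
  have hy4 : (p : ℝ) / ε = y ^ 4 := by
    rw [hy, ← Real.rpow_natCast, ← Real.rpow_mul hpε0]; norm_num
  -- The lower bound on `m` supplies the missing factor `y` in `bKT`, which is of order at least `m²
  -- y³`.
  have hym : δ ^ 2 * y ≤ (m : ℝ) ^ 2 := by
    have h1 : (((p : ℝ) / ε) ^ (1 / 8 : ℝ)) ^ 2 = y := by
      rw [hy, ← Real.rpow_natCast, ← Real.rpow_mul hpε0]; norm_num
    rw [← h1, ← mul_pow]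
    exact pow_le_pow_left₀ (by positivity) hmδ 2
  set T := ⌈A * y ^ 3⌉₊ with hT
  have hTl : A * y ^ 3 ≤ T := Nat.le_ceil _
  have hy31 : 1 ≤ y ^ 3 := one_le_pow₀ hy1
  have hTu : (T : ℝ) ≤ (A + 1) * y ^ 3 := by
    have := Nat.ceil_lt_add_one (show 0 ≤ A * y ^ 3 by positivity)
    rw [← hT] at this
    linarith
  have hAT : A ≤ T := le_trans (le_mul_of_one_le_right (by linarith) hy31) hTl
  have hT0 : (0 : ℝ) < T := by linarith
  have hT₀T : T₀ b ≤ T := by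
    have : (T₀ b : ℝ) ≤ T := by linarith
    exact_mod_cast this
  have hn : 0 < (m : ℝ) * s + r := by positivity
  have hrate := lintegral_fedAve_sub_sq_le hμ hL hσ.le (by positivity) hK hb1 hT₀1 hT₀T hn hsmooth
    hconv hmin hG hr (η := η b) hη (hLm.trans (by gcongr)) hinit
  have hT2 : A * y ^ 4 ≤ (T : ℝ) ^ 2 := by
    calc A * y ^ 4 ≤ (A * y ^ 4) * (A * y ^ 2) :=
          le_mul_of_one_le_right (by positivity)
            (one_le_mul_of_one_le_of_one_le hA1 (one_le_pow₀ hy1))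
      _ = (A * y ^ 3) ^ 2 := by ring
      _ ≤ (T : ℝ) ^ 2 := by gcongr
  have hT3 : A * y ^ 4 ≤ (T : ℝ) ^ 3 :=
    hT2.trans (pow_le_pow_right₀ (by linarith) (by norm_num))
  have hTm : Cb * τ * δ ^ 2 / 2 * (A * y ^ 4) ≤ b * K * T := by
    calc Cb * τ * δ ^ 2 / 2 * (A * y ^ 4) = Cb * τ / 2 * (δ ^ 2 * y) * (A * y ^ 3) := by ring
      _ ≤ Cb * τ / 2 * (m : ℝ) ^ 2 * T := by gcongr
      _ = (Cb * m / 2) * (τ * m) * T := by ring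
      _ ≤ b * K * T := by rw [hKτ]; gcongr
  have happrox : Q.IsApproxSolution θstar ε P (fun ω => fedAve G K b (η b) θ₀ S ξ ω T) := by
    have hX : Measurable fun ω => fedAve G K b (η b) θ₀ S ξ ω T :=
      (measurable_fedAve hG.meas b (η b) θ₀ T).mono hr.choicesSigma_le le_rfl
    have hcont : Continuous Q.risk := continuous_iff_continuousAt.2 fun θ =>
      (FederatedERM.hasGradientAt_risk hsmooth θ).continuousAt
    refine FederatedERM.isApproxSolution_of_lintegral_le hcont hmin hL0.le
      (sub_le_mul_norm_sub_sq_of_stronglyConvex hμ.le (FederatedERM.stronglyConvex_risk hsmooth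
        hconv hn) (FederatedERM.norm_gradient_risk_sub_le hsmooth hn)
        (gradient_eq_zero_of_forall_le hmin)) hX (by positivity) hrate ?_
    refine rate_le hL0.le (by positivity) (by positivity) (by positivity) (by positivity)
      (W := (R + 1) * (R + 2) * (R + 3)) (by gcongr) hCθ.le hσ2 hε hp1 hb1' (by positivity)
      (by linarith) hy4 hT2 hT3 hTm ?_
    rw [hA, hZ₁, hZ₂, hZ₃]
    linarith
  refine (fedAveComplexity_le hb1 hbCb (hT₀1.trans hT₀T) happrox).trans
    (ENNReal.ofReal_le_ofReal ?_)
  rw [hy3]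
  have hφm : (m : ℝ) ≤ φ * m := le_mul_of_one_le_left hm0.le hφ
  have hτm : φ * τ * m ≤ φ * m := by
    calc φ * τ * m = τ * (φ * m) := by ring
      _ ≤ φ * m := mul_le_of_le_one_left (hm0.le.trans hφm) hτ1
  calc (T : ℝ) * (b + φ * τ * m) ≤ ((A + 1) * y ^ 3) * (Cb * (φ * m) + φ * m) := by
        have : (b : ℝ) ≤ Cb * (φ * m) := hbCb.trans (by gcongr)
        gcongr
    _ = _ := by ring
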